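/- Throughout, a *smooth $\mathbb R$-variety* is a nonsingular, separated real algebraic variety in the sense of spaces of real points: a (Zariski) topological space with a sheaf of real-valued regular functions which has a finite cover by open subsets isomorphic to nonsingular Zariski-locally-closed subsets of some $\mathbb R^n$ with their regular functions. Let $\mathrm{Var}_{\mathbb R}$ be the category of smooth $\mathbb R$-varieties, with regular maps as morphisms. The group $\mathbb R/\pi:=\mathbb R/\pi\mathbb Z$ is regarded as a variety via the bijection $\mathbb P^1(\mathbb R)\to\mathbb R/\pi$, $[x,y]\mapsto \mathrm{Arg}(x+y\mathbf i)\bmod \pi$, and $\mathbb C$, $\mathbb C^3$ and $\mathbb P^2(\mathbb C)$ are regarded as real varieties. Put $\mathrm X=\{(a,b,c)\in\mathbb C^3: a+b+c=0\}$, let $\mathbb P(\mathrm X)\subset\mathbb P^2(\mathbb C)$ be its complex projectivization, and put $\mathsf T=\{(\alpha,\beta,\gamma)\in(\mathbb R/\pi)^3:\alpha+\beta+\gamma=0\}$. *Triangles.* Let $\mathfrak T\subset\Omega_{\mathfrak T}:=\mathbb C\times\mathrm X\times\mathbb P^5(\mathbb R)\times(\mathbb R/\pi)^3$ be the set of labeled,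 oriented, possibly-degenerate triangles, that is, of tuples $$\big(B_0;(a,b,c);[a_1,a_2,b_1,b_2,c_1,c_2];(\xi_a,\xi_b,\xi_c)\big)$$ such that: if $(a,b,c)\ne 0$, then $[a_1,a_2,b_1,b_2,c_1,c_2]=[\mathrm{re}\,a,\mathrm{im}\,a,\mathrm{re}\,b,\mathrm{im}\,b,\mathrm{re}\,c,\mathrm{im}\,c]$; if $(a,b,c)=0$, then $a_1+b_1+c_1=a_2+b_2+c_2=0$; and if $a_1+a_2\mathbf i\neq0$, then $\xi_a=\mathrm{Arg}(a_1+a_2\mathbf i)\bmod\pi$, and similarly for $\xi_b$ and $\xi_c$ (the argument of a zero pair is arbitrary). *Triangle classes.* Let $\mathfrak D\subset\Omega_{\mathfrak D}:=\mathbb P(\mathrm X)\times\mathsf T$ be the set of similarity classes of such triangles, that is, of all pairs $\big([a_1+a_2\mathbf i,b_1+b_2\mathbf i,c_1+c_2\mathbf i];(\xi_b-\xi_c,\xi_c-\xi_a,\xi_a-\xi_b)\big)$ obtained from elements of $\mathfrak T$. *Families.* For a smooth $\mathbb R$-variety $B$ let $\mathscr F_{\mathfrak T}(B)$ (resp. $\mathscr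 F_{\mathfrak D}(B)$) be the set of families over $B$, i.e. of morphisms $B\to\Omega_{\mathfrak T}$ with image in $\mathfrak T$ (resp. $B\to\Omega_{\mathfrak D}$ with image in $\mathfrak D$); a morphism $m:B\to C$ acts by the pullback $f\mapsto f\circ m$. This defines contravariant functors $\mathscr F_{\mathfrak T}$ and $\mathscr F_{\mathfrak D}$ from $\mathrm{Var}_{\mathbb R}$ to sets. **Theorem.** With the structures induced from $\Omega_{\mathfrak T}$ and $\Omega_{\mathfrak D}$, the sets $\mathfrak T$ and $\mathfrak D$ are smooth $\mathbb R$-varieties, and they represent $\mathscr F_{\mathfrak T}$ and $\mathscr F_{\mathfrak D}$, respectively, so that the inclusions $\mathfrak T\hookrightarrow\Omega_{\mathfrak T}$ and $\mathfrak D\hookrightarrow\Omega_{\mathfrak D}$ are universal families. Consequently $\mathfrak T$ and $\mathfrak D$ are fine moduli spaces: every family over a smooth $\mathbb R$-variety $B$ is the pullback of the universal family along a unique morphism from $B$, and, for every smooth $\mathbb R$-variety $E$, every natural transformation $\mathscr F_{\mathfrak T}\to\mathrm{Hom}(-,E)$ (resp. $\mathscr F_{\mathfrak D}\to\mathrm{Hom}(-,E)$)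 factors uniquely through the isomorphism $\mathscr F_{\mathfrak T}\cong\mathrm{Hom}(-,\mathfrak T)$ (resp. $\mathscr F_{\mathfrak D}\cong\mathrm{Hom}(-,\mathfrak D)$). -/

import Mathlib

open CategoryTheory Opposite Topology
open scoped LinearAlgebra.Projectivization

namespace TriangleModuli

/-! ## Spaces with real-valued regular functions -/

/-- A space with functions over `ℝ`: a (Zariski) topological space together with a sheaf of
`ℝ`-algebras of real-valued functions whose stalks are local rings. `Reg f x` says that the germ of
`f` at `x` is regular; the sheaf assigns to an open set `U` the functions `f` on `U` with `Reg f x`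
for all `x ∈ U`. The values of `f` away from `x` do not matter, by `reg_congr`. -/
structure RSpace where
  carrier : Type
  top : TopologicalSpace carrier
  Reg : (carrier → ℝ) → carrier → Prop
  reg_congr : ∀ {f g : carrier → ℝ} {x : carrier}, (∀ᶠ y in 𝓝 x, f y = g y) → Reg f x → Reg g x
  reg_eventually : ∀ {f : carrier → ℝ} {x : carrier}, Reg f x → ∀ᶠ y in 𝓝 x, Reg f y
  reg_const : ∀ (c : ℝ) (x : carrier), Reg (fun _ => c) x
  reg_add : ∀ {f g : carrier → ℝ} {x : carrier}, Reg f x → Reg g x → Reg (fun y => f y + g y) x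
  reg_mul : ∀ {f g : carrier → ℝ} {x : carrier}, Reg f x → Reg g x → Reg (fun y => f y * g y) x
  reg_ne_zero : ∀ {f : carrier → ℝ} {x : carrier}, Reg f x → f x ≠ 0 → ∀ᶠ y in 𝓝 x, f y ≠ 0
  reg_inv : ∀ {f : carrier → ℝ} {x : carrier}, Reg f x → f x ≠ 0 → Reg (fun y => (f y)⁻¹) x

instance : CoeSort RSpace Type := ⟨RSpace.carrier⟩

instance (X : RSpace) : TopologicalSpace X := X.top

/-- A morphism of spaces with functions: a continuous map pulling regular functions back to regular
functions. -/
@[ext]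
structure RSpace.Hom (X Y : RSpace) where
  toFun : X → Y
  continuous_toFun : Continuous toFun
  reg_comp : ∀ (x : X) (f : Y → ℝ), Y.Reg f (toFun x) → X.Reg (fun x' => f (toFun x')) x

instance : Category RSpace where
  Hom := RSpace.Hom
  id X := ⟨fun x => x, continuous_id, fun _ _ h => h⟩
  comp f g := ⟨fun x => g.toFun (f.toFun x), g.continuous_toFun.comp f.continuous_toFun,
    fun x h hh => f.reg_comp x _ (g.reg_comp (f.toFun x) h hh)⟩

namespace RSpace

/-- The underlying map of points of a morphism. -/
def onPoints {X Y : RSpace} (f : X ⟶ Y) : X → Y := Hom.toFun f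

/-- The space with functions generated by algebras of functions `A x` (`x : X`) on a topological
space `(X, t)`, where the members of `A x` are thought of as regular near `x`: the topology is
generated by the non-vanishing loci of such functions, and a function is regular at `x` if near `x`
it is a quotient `a / b` with `a b ∈ A x` and `b x ≠ 0`. -/
def generate (X : Type) (t : TopologicalSpace X) (A : X → Subalgebra ℝ (X → ℝ))
    (hA : ∀ x, ∀ f ∈ A x, ∃ U : Set X, IsOpen[t] U ∧ x ∈ U ∧ ∀ y ∈ U, f ∈ A y) : RSpace :=
  let τ : TopologicalSpace X := .generateFrom
    {W | ∃ (U : Set X) (q : X → ℝ), IsOpen[t] U ∧ (∀ y ∈ U, q ∈ A y) ∧ W = {y | y ∈ U ∧ q y ≠ 0}}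
  have key : ∀ x, ∀ f ∈ A x, f x ≠ 0 → ∀ᶠ y in @nhds X τ x, f ∈ A y ∧ f y ≠ 0 := by
    intro x f hf hx
    obtain ⟨U, hU, hxU, hfU⟩ := hA x f hf
    have hopen : IsOpen[τ] {y | y ∈ U ∧ f y ≠ 0} :=
      .basic _ ⟨U, f, hU, hfU, rfl⟩
    filter_upwards [@IsOpen.mem_nhds X τ x _ hopen ⟨hxU, hx⟩] with y hy
    exact ⟨hfU y hy.1, hy.2⟩
  have key' : ∀ x, ∀ f ∈ A x, ∀ᶠ y in @nhds X τ x, f ∈ A y := by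
    intro x f hf
    obtain ⟨U, hU, hxU, hfU⟩ := hA x f hf
    have hopen : IsOpen[τ] {y | y ∈ U ∧ (1 : X → ℝ) y ≠ 0} :=
      .basic _ ⟨U, 1, hU, fun y _ => one_mem _, rfl⟩
    filter_upwards [@IsOpen.mem_nhds X τ x _ hopen ⟨hxU, by simp⟩] with y hy
    exact hfU y hy.1
  { carrier := X
    top := τ
    Reg := fun f x => ∃ a ∈ A x, ∃ b ∈ A x, b x ≠ 0 ∧ ∀ᶠ y in @nhds X τ x, f y = a y / b y
    reg_congr := by
      rintro f g x hfg ⟨a, ha, b, hb, hbx, h⟩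
      refine ⟨a, ha, b, hb, hbx, ?_⟩
      filter_upwards [hfg, h] with y h1 h2
      rw [← h1, h2]
    reg_eventually := by
      rintro f x ⟨a, ha, b, hb, hbx, h⟩
      filter_upwards [key' x a ha, key x b hb hbx, eventually_eventually_nhds.2 h] with y h1 h2 h3
      exact ⟨a, h1, b, h2.1, h2.2, h3⟩
    reg_const := fun c x => ⟨algebraMap ℝ (X → ℝ) c, (A x).algebraMap_mem c, 1, one_mem _,
      by simp, by simp⟩
    reg_add := by
      rintro f g x ⟨a, ha, b, hb, hbx, h⟩ ⟨c, hc, d, hd, hdx, h'⟩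
      refine ⟨a * d + b * c, add_mem (mul_mem ha hd) (mul_mem hb hc), b * d, mul_mem hb hd,
        mul_ne_zero hbx hdx, ?_⟩
      filter_upwards [h, h', key x b hb hbx, key x d hd hdx] with y h1 h2 h3 h4
      rw [h1, h2, div_add_div _ _ h3.2 h4.2]
      rfl
    reg_mul := by
      rintro f g x ⟨a, ha, b, hb, hbx, h⟩ ⟨c, hc, d, hd, hdx, h'⟩
      refine ⟨a * c, mul_mem ha hc, b * d, mul_mem hb hd, mul_ne_zero hbx hdx, ?_⟩
      filter_upwards [h, h'] with y h1 h2
      rw [h1, h2, div_mul_div_comm]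
      rfl
    reg_ne_zero := by
      rintro f x ⟨a, ha, b, hb, hbx, h⟩ hfx
      have hax : a x ≠ 0 := by
        rintro h0
        exact hfx (by rw [h.self_of_nhds, h0, zero_div])
      filter_upwards [h, key x a ha hax, key x b hb hbx] with y h1 h2 h3
      rw [h1]
      exact div_ne_zero h2.2 h3.2
    reg_inv := by
      rintro f x ⟨a, ha, b, hb, hbx, h⟩ hfx
      have hax : a x ≠ 0 := by
        rintro h0
        exact hfx (by rw [h.self_of_nhds, h0, zero_div])
      refine ⟨b, hb, a, ha, hax, ?_⟩
      filter_upwards [h] with y h1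
      rw [h1, inv_div] }

/-- Affine space: a real vector space `V` with the Zariski topology. The polynomial functions are
the algebra generated by the linear forms, and a function is regular if it is locally a quotient of
polynomial functions with non-vanishing denominator. -/
def affine (V : Type) [AddCommGroup V] [Module ℝ V] : RSpace :=
  generate V (⊤ : TopologicalSpace V) (fun _ => Algebra.adjoin ℝ {f | ∃ l : V →ₗ[ℝ] ℝ, f = fun v => l v})
    (fun _ _ hf => ⟨Set.univ, @isOpen_univ V ⊤, trivial, fun _ _ => hf⟩)

/-- A subset with the induced structure: regular functions are locally restrictions of regular
functions of the ambient space. -/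
def sub (X : RSpace) (S : Set X) : RSpace where
  carrier := S
  top := inferInstance
  Reg f x := ∃ g : X → ℝ, X.Reg g x ∧ ∀ᶠ y in 𝓝 x, f y = g y
  reg_congr := by
    rintro f g x hfg ⟨h, hh, hfh⟩
    refine ⟨h, hh, ?_⟩
    filter_upwards [hfg, hfh] with y h1 h2
    rw [← h1, h2]
  reg_eventually := by
    rintro f x ⟨h, hh, hfh⟩
    filter_upwards [eventually_eventually_nhds.2 hfh,
      continuous_subtype_val.continuousAt.eventually (X.reg_eventually hh)] with y h1 h2
    exact ⟨h, h2, h1⟩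
  reg_const c x := ⟨_, X.reg_const c x, by simp⟩
  reg_add := by
    rintro f g x ⟨a, ha, h⟩ ⟨b, hb, h'⟩
    refine ⟨_, X.reg_add ha hb, ?_⟩
    filter_upwards [h, h'] with y h1 h2
    rw [h1, h2]
  reg_mul := by
    rintro f g x ⟨a, ha, h⟩ ⟨b, hb, h'⟩
    refine ⟨_, X.reg_mul ha hb, ?_⟩
    filter_upwards [h, h'] with y h1 h2
    rw [h1, h2]
  reg_ne_zero := by
    rintro f x ⟨a, ha, h⟩ hx
    filter_upwards [h, continuous_subtype_val.continuousAt.eventually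
      (X.reg_ne_zero ha (by rwa [← h.self_of_nhds]))] with y h1 h2
    rwa [h1]
  reg_inv := by
    rintro f x ⟨a, ha, h⟩ hx
    refine ⟨_, X.reg_inv ha (by rwa [← h.self_of_nhds]), ?_⟩
    filter_upwards [h] with y h1
    rw [h1]

/-- The quotient structure along a map `φ : X → Y`: a set is open if its preimage is, and a function
is regular at `y` if, over some open neighbourhood of `y`, its pullback to `X` is regular. -/
def quotient (X : RSpace) {Y : Type} (φ : X → Y) : RSpace :=
  let τ : TopologicalSpace Y := .coinduced φ X.top
  have hopen : ∀ {U : Set Y}, IsOpen[τ] U ↔ IsOpen (φ ⁻¹' U) := isOpen_coinduced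
  { carrier := Y
    top := τ
    Reg := fun f y => ∃ U : Set Y, IsOpen[τ] U ∧ y ∈ U ∧
      ∀ x, φ x ∈ U → X.Reg (fun x' => f (φ x')) x
    reg_congr := by
      rintro f g y hfg ⟨U, hU, hy, h⟩
      obtain ⟨W, hW, hWo, hyW⟩ := eventually_nhds_iff.1 hfg
      refine ⟨U ∩ W, IsOpen.inter hU hWo, ⟨hy, hyW⟩, fun x hx => X.reg_congr ?_ (h x hx.1)⟩
      filter_upwards [(hopen.1 hWo).mem_nhds hx.2] with x' hx'
      exact hW _ hx'
    reg_eventually := by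
      rintro f y ⟨U, hU, hy, h⟩
      filter_upwards [IsOpen.mem_nhds hU hy] with z hz
      exact ⟨U, hU, hz, h⟩
    reg_const := fun c y => ⟨Set.univ, isOpen_univ, trivial, fun x _ => X.reg_const c x⟩
    reg_add := by
      rintro f g y ⟨U, hU, hy, h⟩ ⟨W, hW, hy', h'⟩
      exact ⟨U ∩ W, IsOpen.inter hU hW, ⟨hy, hy'⟩,
        fun x hx => X.reg_add (h x hx.1) (h' x hx.2)⟩
    reg_mul := by
      rintro f g y ⟨U, hU, hy, h⟩ ⟨W, hW, hy', h'⟩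
      exact ⟨U ∩ W, IsOpen.inter hU hW, ⟨hy, hy'⟩,
        fun x hx => X.reg_mul (h x hx.1) (h' x hx.2)⟩
    reg_ne_zero := by
      rintro f y ⟨U, hU, hy, h⟩ hfy
      have ho : IsOpen[τ] {z | z ∈ U ∧ f z ≠ 0} := by
        refine hopen.2 (isOpen_iff_mem_nhds.2 fun x hx => ?_)
        filter_upwards [(hopen.1 hU).mem_nhds hx.1, X.reg_ne_zero (h x hx.1) hx.2] with x' h1 h2
        exact ⟨h1, h2⟩
      filter_upwards [IsOpen.mem_nhds ho ⟨hy, hfy⟩] with z hz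
      exact hz.2
    reg_inv := by
      rintro f y ⟨U, hU, hy, h⟩ hfy
      have ho : IsOpen[τ] {z | z ∈ U ∧ f z ≠ 0} := by
        refine hopen.2 (isOpen_iff_mem_nhds.2 fun x hx => ?_)
        filter_upwards [(hopen.1 hU).mem_nhds hx.1, X.reg_ne_zero (h x hx.1) hx.2] with x' h1 h2
        exact ⟨h1, h2⟩
      exact ⟨_, ho, ⟨hy, hfy⟩, fun x hx => X.reg_inv (h x hx.1) hx.2⟩ }

/-- Polynomial expressions in functions regular at the two components of `p`. -/
def prodAlg (X Y : RSpace) (p : X × Y) : Subalgebra ℝ (X × Y → ℝ) :=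
  Algebra.adjoin ℝ ({h | ∃ f : X → ℝ, X.Reg f p.1 ∧ h = fun z => f z.1} ∪
    {h | ∃ g : Y → ℝ, Y.Reg g p.2 ∧ h = fun z => g z.2})

theorem prodAlg_open (X Y : RSpace) (p : X × Y) (h : X × Y → ℝ) (hh : h ∈ prodAlg X Y p) :
    ∃ U : Set (X × Y), IsOpen U ∧ p ∈ U ∧ ∀ y ∈ U, h ∈ prodAlg X Y y := by
  suffices H : ∀ᶠ y in 𝓝 p, h ∈ prodAlg X Y y by
    obtain ⟨U, hU, hUo, hp⟩ := eventually_nhds_iff.1 H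
    exact ⟨U, hUo, hp, hU⟩
  induction hh using Algebra.adjoin_induction with
  | mem h hh =>
    rcases hh with ⟨f, hf, rfl⟩ | ⟨g, hg, rfl⟩
    · filter_upwards [continuous_fst.continuousAt.eventually (X.reg_eventually hf)] with y hy
      exact Algebra.subset_adjoin (Or.inl ⟨f, hy, rfl⟩)
    · filter_upwards [continuous_snd.continuousAt.eventually (Y.reg_eventually hg)] with y hy
      exact Algebra.subset_adjoin (Or.inr ⟨g, hy, rfl⟩)
  | algebraMap r => exact Filter.Eventually.of_forall fun y => (prodAlg X Y y).algebraMap_mem r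
  | add f g _ _ hf hg =>
    filter_upwards [hf, hg] with y h1 h2
    exact add_mem h1 h2
  | mul f g _ _ hf hg =>
    filter_upwards [hf, hg] with y h1 h2
    exact mul_mem h1 h2

/-- The product: its topology is generated by the non-vanishing loci, in products of open sets, of
polynomial expressions `∑ fᵢ(x) gᵢ(y)` in regular functions of the factors, and its regular
functions are locally quotients of such expressions. -/
def prod (X Y : RSpace) : RSpace :=
  generate (X × Y) inferInstance (prodAlg X Y) (prodAlg_open X Y)

/-- Projective space `ℙ(V)` over `K` (`K = ℝ` or `ℂ`) as a space with functions over `ℝ`: the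
quotient of `V ∖ {0}`. -/
def projective (K V : Type) [DivisionRing K] [AddCommGroup V] [Module K V] [Module ℝ V] : RSpace :=
  quotient (sub (affine V) {v : V | v ≠ 0})
    (fun v : {v : V // v ≠ 0} => Projectivization.mk K v.1 v.2)

/-! ## Smooth real varieties -/

/-- The subset of `ℝⁿ` where the polynomials `P₁, …, Pₖ` vanish and `q` does not. -/
def locus {n k : ℕ} (P : Fin k → MvPolynomial (Fin n) ℝ) (q : MvPolynomial (Fin n) ℝ) :
    Set (Fin n → ℝ) :=
  {x | (∀ i, MvPolynomial.eval x (P i) = 0) ∧ MvPolynomial.eval x q ≠ 0}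

/-- `X` is isomorphic to a Zariski-open subset of a real algebraic set in some `ℝⁿ` that is defined
there by equations `P₁ = ⋯ = Pₖ = 0` with everywhere linearly independent gradients. (Every
Zariski-open subset of `ℝⁿ` is the non-vanishing locus of a single polynomial `q`.) -/
def IsSmoothAffine (X : RSpace) : Prop :=
  ∃ (n k : ℕ) (P : Fin k → MvPolynomial (Fin n) ℝ) (q : MvPolynomial (Fin n) ℝ),
    (∀ x ∈ locus P q, LinearIndependent ℝ
      (fun (i : Fin k) (j : Fin n) => MvPolynomial.eval x (MvPolynomial.pderiv j (P i)))) ∧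
    Nonempty (X ≅ sub (affine (Fin n → ℝ)) (locus P q))

/-- A smooth (that is, nonsingular) real algebraic variety: a separated space with functions with a
finite cover by open subsets that are isomorphic to nonsingular real algebraic sets. -/
def IsSmoothVariety : ObjectProperty RSpace := fun X =>
  IsClosed {p : prod X X | (show X × X from p).1 = (show X × X from p).2} ∧
  ∃ (m : ℕ) (U : Fin m → Set X), (∀ i, IsOpen (U i)) ∧ (∀ x, ∃ i, x ∈ U i) ∧
    ∀ i, IsSmoothAffine (sub X (U i))

end RSpace

/-- The category of smooth `ℝ`-varieties. -/
abbrev SmoothVar := RSpace.IsSmoothVariety.FullSubcategory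

/-! ## Triangles and triangle classes -/

/-- The principal argument modulo `π`. -/
noncomputable def argModPi (z : ℂ) : AddCircle Real.pi := (Complex.arg z : AddCircle Real.pi)

theorem argModPi_real_mul (t : ℝ) (ht : t ≠ 0) (z : ℂ) : argModPi (t * z) = argModPi z := by
  have hneg : ∀ w : ℂ, argModPi (-w) = argModPi w := by
    intro w
    by_cases hw : w = 0
    · simp [hw]
    have h := Complex.arg_neg_coe_angle hw
    rw [← Real.Angle.coe_add, Real.Angle.angle_eq_iff_two_pi_dvd_sub] at h
    obtain ⟨k, hk⟩ := h
    refine QuotientAddGroup.eq_iff_sub_mem.2 (AddSubgroup.mem_zmultiples_iff.2 ⟨2 * k + 1, ?_⟩)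
    simp only [zsmul_eq_mul, Int.cast_add, Int.cast_mul, Int.cast_ofNat, Int.cast_one]
    linarith
  rcases lt_or_gt_of_ne ht with h | h
  · rw [← hneg]
    have : -((t : ℂ) * z) = ((-t : ℝ) : ℂ) * z := by push_cast; ring
    rw [this, argModPi, Complex.arg_real_mul z (neg_pos.2 h), argModPi]
  · rw [argModPi, Complex.arg_real_mul z h, argModPi]

/-- The bijection `ρ : ℙ¹(ℝ) → ℝ/π`, `[x, y] ↦ Arg(x + yi) mod π`. -/
noncomputable def rho : ℙ ℝ (Fin 2 → ℝ) → AddCircle Real.pi :=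
  Projectivization.lift (fun v => argModPi (Complex.mk (v.1 0) (v.1 1))) (by
    rintro ⟨v, hv⟩ ⟨w, hw⟩ t h
    have ht : t ≠ 0 := by
      rintro rfl
      exact hv (by simpa using h)
    have e : Complex.mk (v 0) (v 1) = (t : ℂ) * Complex.mk (w 0) (w 1) := by
      have h' : v = t • w := h
      apply Complex.ext <;> simp [h']
    change argModPi (Complex.mk (v 0) (v 1)) = argModPi (Complex.mk (w 0) (w 1))
    rw [e, argModPi_real_mul t ht])

/-- `ℝ/π` as a real variety, with the structure transported from `ℙ¹(ℝ)` along `ρ`. -/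
noncomputable def circle : RSpace := (RSpace.projective ℝ (Fin 2 → ℝ)).quotient rho

/-- `(ℝ/π)³`. -/
noncomputable def circle3 : RSpace := circle.prod (circle.prod circle)

/-- The plane `V(X + Y + Z) ⊂ ℂ³` of side-vectors `(a, b, c)`. -/
abbrev SideVectors : Type := {s : Fin 3 → ℂ // s 0 + s 1 + s 2 = 0}

noncomputable def sideVectors : RSpace :=
  (RSpace.affine (Fin 3 → ℂ)).sub {s : Fin 3 → ℂ | s 0 + s 1 + s 2 = 0}

/-- The ambient space `ℂ × V(X + Y + Z) × ℙ⁵(ℝ) × (ℝ/π)³` of the triangles. Its points are the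
tuples `(B₀; (a, b, c); [a₁, a₂, b₁, b₂, c₁, c₂]; (ξ₁, ξ₂, ξ₃))`. -/
noncomputable def triangleAmbient : RSpace :=
  (RSpace.affine ℂ).prod (sideVectors.prod ((RSpace.projective ℝ (Fin 6 → ℝ)).prod circle3))

/-- The real coordinates `(re a, im a, re b, im b, re c, im c)` of `(a, b, c) ∈ ℂ³`. -/
def realCoords (s : Fin 3 → ℂ) : Fin 6 → ℝ :=
  ![(s 0).re, (s 0).im, (s 1).re, (s 1).im, (s 2).re, (s 2).im]

/-- The vector `(v₀ + v₁i, v₂ + v₃i, v₄ + v₅i) ∈ ℂ³` with the given real coordinates. -/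
def complexCoords (v : Fin 6 → ℝ) : Fin 3 → ℂ := ![⟨v 0, v 1⟩, ⟨v 2, v 3⟩, ⟨v 4, v 5⟩]

/-- The conditions for `(B₀; s; p; (ξ₁, ξ₂, ξ₃))`, with side-vectors `s = (a, b, c)`, `a + b + c = 0`,
and `p = [a₁, a₂, b₁, b₂, c₁, c₂]`, to be a labeled, oriented, possibly-degenerate triangle. There is
no condition on the basepoint, nor on an argument `ξ` whose pair in `p` is zero. -/
def IsTriangle (s : Fin 3 → ℂ) (p : ℙ ℝ (Fin 6 → ℝ)) (ξ₁ ξ₂ ξ₃ : AddCircle Real.pi) : Prop :=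
  (s ≠ 0 → ∃ h : realCoords s ≠ 0, p = Projectivization.mk ℝ (realCoords s) h) ∧
  ∃ (v : Fin 6 → ℝ) (hv : v ≠ 0), p = Projectivization.mk ℝ v hv ∧
    (s = 0 → v 0 + v 2 + v 4 = 0 ∧ v 1 + v 3 + v 5 = 0) ∧
    (complexCoords v 0 ≠ 0 → ξ₁ = argModPi (complexCoords v 0)) ∧
    (complexCoords v 1 ≠ 0 → ξ₂ = argModPi (complexCoords v 1)) ∧
    (complexCoords v 2 ≠ 0 → ξ₃ = argModPi (complexCoords v 2))

/-- The set `𝔗` of labeled, oriented, possibly-degenerate triangles. -/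
def triangles : Set (ℂ × SideVectors × ℙ ℝ (Fin 6 → ℝ) ×
    AddCircle Real.pi × AddCircle Real.pi × AddCircle Real.pi) :=
  {(_, s, p, ξ₁, ξ₂, ξ₃) | IsTriangle s.1 p ξ₁ ξ₂ ξ₃}

/-- `ℙ(V(X + Y + Z)) ⊂ ℙ²(ℂ)`. -/
def projSideSet : Set (ℙ ℂ (Fin 3 → ℂ)) :=
  {c | ∃ (s : Fin 3 → ℂ) (hs : s ≠ 0), c = Projectivization.mk ℂ s hs ∧ s 0 + s 1 + s 2 = 0}

noncomputable def projSideVectors : RSpace := (RSpace.projective ℂ (Fin 3 → ℂ)).sub projSideSet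

/-- The torus `V(P + Q + R) ⊂ (ℝ/π)³`. -/
def torusSet : Set (AddCircle Real.pi × AddCircle Real.pi × AddCircle Real.pi) :=
  {(α, β, γ) | α + β + γ = 0}

noncomputable def torus : RSpace := circle3.sub torusSet

/-- The ambient space of the triangle classes. -/
noncomputable def classAmbient : RSpace := projSideVectors.prod torus

/-- `(c; α, β, γ)` is the class `[T]` of the triangle `T = (B₀; s; p; ξ₁, ξ₂, ξ₃)`, that is,
`c = [a₁ + a₂i, b₁ + b₂i, c₁ + c₂i]` and the interior angles of `T` are
`(α, β, γ) = (ξ₂ - ξ₃, ξ₃ - ξ₁, ξ₁ - ξ₂)`. -/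
def IsClassOf (c : ℙ ℂ (Fin 3 → ℂ)) (α β γ : AddCircle Real.pi)
    (p : ℙ ℝ (Fin 6 → ℝ)) (ξ₁ ξ₂ ξ₃ : AddCircle Real.pi) : Prop :=
  (∃ (v : Fin 6 → ℝ) (hv : v ≠ 0) (hw : complexCoords v ≠ 0),
    p = Projectivization.mk ℝ v hv ∧ c = Projectivization.mk ℂ (complexCoords v) hw) ∧
  α = ξ₂ - ξ₃ ∧ β = ξ₃ - ξ₁ ∧ γ = ξ₁ - ξ₂

/-- The set `𝔇` of similarity classes of labeled, oriented, possibly-degenerate triangles. -/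
def triangleClasses : Set (projSideSet × torusSet) :=
  {(c, θ) | ∃ T ∈ triangles,
    IsClassOf c.1 θ.1.1 θ.1.2.1 θ.1.2.2 T.2.2.1 T.2.2.2.1 T.2.2.2.2.1 T.2.2.2.2.2}

/-! ## Families and moduli functors -/

/-- The functor sending a smooth variety `B` to the set of families over `B`, that is, of morphisms
`B → Ω` whose image is in the set `S`, and a morphism `m` to the pullback `f ↦ f ∘ m`. -/
def familyFunctor (Ω : RSpace) (S : Set Ω) : SmoothVarᵒᵖ ⥤ Type where
  obj B := {f : B.unop.obj ⟶ Ω // ∀ b, RSpace.onPoints f b ∈ S}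
  map m := TypeCat.ofHom fun f => ⟨m.unop.hom ≫ f.1, fun b => f.2 (RSpace.onPoints m.unop.hom b)⟩

/-- The tautological family over `S` itself, for a set `S ⊆ Ω` that is a smooth variety with the
induced structure: the inclusion `S → Ω`. -/
def tautologicalFamily (Ω : RSpace) (S : Set Ω) (h : (Ω.sub S).IsSmoothVariety) :
    (familyFunctor Ω S).obj (op ⟨Ω.sub S, h⟩) :=
  ⟨RSpace.Hom.mk Subtype.val continuous_subtype_val
    (fun _ f hf => ⟨f, hf, Filter.Eventually.of_forall fun _ => rfl⟩), fun b => b.2⟩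

/-- `M` represents `F` with universal family `u ∈ F(M)`, and so is a fine moduli space for `F`: there
are natural bijections `Hom(B, M) ≃ F(B)` under which `u` corresponds to the identity, every family
is the pullback of `u` along a unique morphism, and every natural transformation from `F` to a
functor `Hom(-, E)` factors uniquely through `F ≅ Hom(-, M)`. -/
def IsFineModuliSpace (F : SmoothVarᵒᵖ ⥤ Type) (M : SmoothVar) (u : F.obj (op M)) : Prop :=
  ∃ R : F.RepresentableBy M,
    R.homEquiv (𝟙 M) = u ∧
    (∀ (B : SmoothVar) (f : F.obj (op B)), ∃! m : B ⟶ M, F.map m.op u = f) ∧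
    (∀ (E : SmoothVar) (Ψ : F ⟶ yoneda.obj E),
      ∃! Φ : yoneda.obj M ⟶ yoneda.obj E, R.toIso.inv ≫ Φ = Ψ)

/-- The moduli functor of triangles. -/
noncomputable abbrev triangleFunctor : SmoothVarᵒᵖ ⥤ Type :=
  familyFunctor triangleAmbient triangles

/-- The moduli functor of triangle classes. -/
noncomputable abbrev classFunctor : SmoothVarᵒᵖ ⥤ Type :=
  familyFunctor classAmbient triangleClasses

/-- The space of triangles `𝔗`, with the structure induced from the ambient space. -/
noncomputable abbrev triangleSpace : RSpace := triangleAmbient.sub triangles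

/-- The space of triangle classes `𝔇`, with the structure induced from the ambient space. -/
noncomputable abbrev classSpace : RSpace := classAmbient.sub triangleClasses

end TriangleModuli

/-! A morphism into `Ω` with image in `S` is the same thing as a morphism into `Ω.sub S`
(`regAt_sub`). Hence, as soon as `Ω.sub S` is a smooth variety, it represents the functor of
families, with the inclusion as universal family, and the factorization of natural transformations
is formal (`isFineModuliSpace_tautologicalFamily`). What has to be proved is that the two spaces are
smooth varieties.

Separatedness follows from a stronger property that passes to products and subspaces: global regular
functions separate points. Projective spaces have it, because `∑ |vᵢ|²` vanishes only at `0` and so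
is a legitimate global denominator (`SeparatesPoints.projective`).

Smoothness comes from explicit charts onto principal open subsets of `ℝ⁶` and `ℝ²`. By
`isTriangle_iff`, a triangle is `(B₀; t w; [w]; ξ)` with `t` real, `w ≠ 0` of sum zero, and `ξ`
compatible with the arguments of `w`. The sum condition leaves at least two components of `w`
nonzero, say those at `i + 1` and `i + 2` (`exists_two_ne_zero`), so only the argument at `i` can be
free. A real scaling brings `w (i + 1)` to the form `e' (1 + m' I)`, and `w i = r e (1 + m I)`,
where `m` is the slope of `ξ` at `i` and `r` is real. The slope `m` still makes sense when `r = 0`: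
this is a chart of the blow-up of `ℂ` at `0` (`eq_re_mul_slopeVec_slope`). The last component is
determined by the sum. The coordinates are the two of `B₀`, the scale, `r`, `m` and `m'`, subject
only to `w (i + 2) ≠ 0`. Three values of `i`, and `e`, `e'` in `{1, I}`, give a finite cover.

For classes, a complex scaling achieves `w (i + 1) = 1`, and the coordinates `r`, `m` of `w i`
remain. Here `m` is the slope of the angle of index `i + 2`, the difference of the arguments at `i`
and `i + 1`. -/

namespace TriangleModuli

namespace RSpace

/-! ## Regular functions -/

section Reg

variable {X : RSpace} {x : X}

theorem reg_neg {f : X → ℝ} (hf : X.Reg f x) : X.Reg (fun y => -f y) x := by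
  simpa using X.reg_mul (X.reg_const (-1) x) hf

theorem reg_sub {f g : X → ℝ} (hf : X.Reg f x) (hg : X.Reg g x) :
    X.Reg (fun y => f y - g y) x := by
  simpa [sub_eq_add_neg] using X.reg_add hf (reg_neg hg)

theorem reg_div {f g : X → ℝ} (hf : X.Reg f x) (hg : X.Reg g x) (h : g x ≠ 0) :
    X.Reg (fun y => f y / g y) x := by
  simpa [div_eq_mul_inv] using X.reg_mul hf (X.reg_inv hg h)

theorem reg_sum {ι : Type*} (s : Finset ι) {f : ι → X → ℝ} (hf : ∀ i ∈ s, X.Reg (f i) x) :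
    X.Reg (fun y => ∑ i ∈ s, f i y) x := by
  classical
  induction s using Finset.induction_on with
  | empty => simpa using X.reg_const 0 x
  | insert a s ha ih =>
    simp only [Finset.sum_insert ha]
    exact X.reg_add (hf a (by simp)) (ih fun i hi => hf i (by simp [hi]))

end Reg

/-- A complex-valued function whose real and imaginary parts are regular. -/
def RegC (X : RSpace) (f : X → ℂ) (x : X) : Prop :=
  X.Reg (fun y => (f y).re) x ∧ X.Reg (fun y => (f y).im) x

namespace RegC

variable {X : RSpace} {x : X} {f g : X → ℂ}

theorem const (c : ℂ) (x : X) : X.RegC (fun _ => c) x := ⟨X.reg_const _ x, X.reg_const _ x⟩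

theorem ofReal {f : X → ℝ} (hf : X.Reg f x) : X.RegC (fun y => (f y : ℂ)) x := by
  constructor
  · simpa using hf
  · simpa using X.reg_const 0 x

theorem add (hf : X.RegC f x) (hg : X.RegC g x) : X.RegC (fun y => f y + g y) x := by
  constructor
  · simpa using X.reg_add hf.1 hg.1
  · simpa using X.reg_add hf.2 hg.2

theorem mul (hf : X.RegC f x) (hg : X.RegC g x) : X.RegC (fun y => f y * g y) x := by
  constructor
  · simpa using reg_sub (X.reg_mul hf.1 hg.1) (X.reg_mul hf.2 hg.2)
  · simpa using X.reg_add (X.reg_mul hf.1 hg.2) (X.reg_mul hf.2 hg.1)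

theorem neg (hf : X.RegC f x) : X.RegC (fun y => -f y) x := by
  constructor
  · simpa using reg_neg hf.1
  · simpa using reg_neg hf.2

theorem sub (hf : X.RegC f x) (hg : X.RegC g x) : X.RegC (fun y => f y - g y) x := by
  simpa [sub_eq_add_neg] using hf.add hg.neg

theorem conj (hf : X.RegC f x) : X.RegC (fun y => (starRingEnd ℂ) (f y)) x := by
  constructor
  · simpa using hf.1
  · simpa using reg_neg hf.2

theorem normSq (hf : X.RegC f x) : X.Reg (fun y => Complex.normSq (f y)) x := by
  simpa [Complex.normSq_apply] using X.reg_add (X.reg_mul hf.1 hf.1) (X.reg_mul hf.2 hf.2)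

theorem inv (hf : X.RegC f x) (h : f x ≠ 0) : X.RegC (fun y => (f y)⁻¹) x := by
  have hn : Complex.normSq (f x) ≠ 0 := by simpa using h
  constructor
  · simpa using reg_div hf.1 hf.normSq hn
  · simpa using reg_div (reg_neg hf.2) hf.normSq hn

theorem div (hf : X.RegC f x) (hg : X.RegC g x) (h : g x ≠ 0) :
    X.RegC (fun y => f y / g y) x := by
  simpa [div_eq_mul_inv] using hf.mul (hg.inv h)

theorem eventually_ne (hf : X.RegC f x) (h : f x ≠ 0) : ∀ᶠ y in 𝓝 x, f y ≠ 0 :=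
  (X.reg_ne_zero hf.normSq (by simpa using h)).mono fun _ hy => by simpa using hy

end RegC

/-! ## Maps that are regular at a point -/

/-- A map is regular at `x` if it is continuous there and pulls germs of regular functions back to
germs of regular functions. -/
def RegAt (X Y : RSpace) (f : X → Y) (x : X) : Prop :=
  ContinuousAt f x ∧ ∀ g : Y → ℝ, Y.Reg g (f x) → X.Reg (fun y => g (f y)) x

namespace RegAt

variable {X Y Z : RSpace}

theorem comp {f : X → Y} {g : Y → Z} {x : X} (hg : RegAt Y Z g (f x)) (hf : RegAt X Y f x) :
    RegAt X Z (fun y => g (f y)) x :=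
  ⟨ContinuousAt.comp (f := f) hg.1 hf.1, fun k hk => hf.2 _ (hg.2 k hk)⟩

theorem reg {f : X → Y} {x : X} (hf : RegAt X Y f x) {g : Y → ℝ} (hg : Y.Reg g (f x)) :
    X.Reg (fun y => g (f y)) x := hf.2 g hg

theorem regC {f : X → Y} {x : X} (hf : RegAt X Y f x) {g : Y → ℂ} (hg : Y.RegC g (f x)) :
    X.RegC (fun y => g (f y)) x := ⟨hf.2 _ hg.1, hf.2 _ hg.2⟩

theorem congr {f g : X → Y} {x : X} (hf : RegAt X Y f x) (h : ∀ᶠ y in 𝓝 x, f y = g y) :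
    RegAt X Y g x := by
  refine ⟨hf.1.congr h, fun k hk => X.reg_congr (h.mono fun y hy => congrArg k hy) (hf.reg ?_)⟩
  rwa [h.self_of_nhds]

theorem continuous {f : X → Y} (h : ∀ x, RegAt X Y f x) : Continuous f :=
  continuous_iff_continuousAt.2 fun x => (h x).1

/-- The morphism given by an everywhere regular map. -/
def hom (f : X → Y) (h : ∀ x, RegAt X Y f x) : X ⟶ Y :=
  Hom.mk f (RegAt.continuous h) fun x => (h x).2

end RegAt

/-! ### Maps into spaces generated by algebras of functions. -/

theorem generate_reg {X : Type} {t : TopologicalSpace X} {A : X → Subalgebra ℝ (X → ℝ)}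
    {hA : ∀ x, ∀ f ∈ A x, ∃ U : Set X, IsOpen[t] U ∧ x ∈ U ∧ ∀ y ∈ U, f ∈ A y} {f : X → ℝ} {x : X}
    (hf : f ∈ A x) : (generate X t A hA).Reg f x :=
  ⟨f, hf, 1, one_mem _, by simp, by simp⟩

theorem generate_isOpen {X : Type} {t : TopologicalSpace X} {A : X → Subalgebra ℝ (X → ℝ)}
    {hA : ∀ x, ∀ f ∈ A x, ∃ U : Set X, IsOpen[t] U ∧ x ∈ U ∧ ∀ y ∈ U, f ∈ A y} {U : Set X}
    (hU : IsOpen[t] U) : IsOpen[(generate X t A hA).top] U :=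
  .basic _ ⟨U, 1, hU, fun y _ => one_mem _, by ext; simp⟩

/-- The basic open sets are non-vanishing loci of members of the algebras, and a regular function is
never zero near a point where it is nonzero. So continuity for the finer topology follows from
continuity for `t` and regularity of the pulled-back generators. -/
theorem regAt_generate {Z : RSpace} {X : Type} {t : TopologicalSpace X}
    {A : X → Subalgebra ℝ (X → ℝ)}
    {hA : ∀ x, ∀ f ∈ A x, ∃ U : Set X, IsOpen[t] U ∧ x ∈ U ∧ ∀ y ∈ U, f ∈ A y} {h : Z → X} {z : Z}
    (hc : @ContinuousAt Z X _ t h z) (hr : ∀ f ∈ A (h z), Z.Reg (fun y => f (h y)) z) :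
    RegAt Z (generate X t A hA) h z := by
  have hcont : @ContinuousAt Z (generate X t A hA) _ (generate X t A hA).top h z := by
    refine TopologicalSpace.tendsto_nhds_generateFrom_iff.2 ?_
    rintro W ⟨U, q, hU, hq, rfl⟩ ⟨hzU, hqz⟩
    filter_upwards [hc.preimage_mem_nhds (@IsOpen.mem_nhds X t _ _ hU hzU),
      Z.reg_ne_zero (hr q (hq _ hzU)) hqz] with y h1 h2
    exact ⟨h1, h2⟩
  refine ⟨hcont, ?_⟩
  rintro g ⟨a, ha, b, hb, hbx, hg⟩
  refine Z.reg_congr ?_ (reg_div (hr a ha) (hr b hb) hbx)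
  filter_upwards [hcont.eventually hg] with y hy
  exact hy.symm

/-! ### Affine spaces -/

section affine

variable {V W : Type} [AddCommGroup V] [Module ℝ V] [AddCommGroup W] [Module ℝ W]

theorem affine_reg (l : V →ₗ[ℝ] ℝ) (v : V) : (affine V).Reg (fun v => l v) v :=
  generate_reg (Algebra.subset_adjoin ⟨l, rfl⟩)

theorem regAt_affine {X : RSpace} {f : X → V} {x : X}
    (h : ∀ l : V →ₗ[ℝ] ℝ, X.Reg (fun y => l (f y)) x) : RegAt X (affine V) f x := by
  -- The topology `⊤` is indiscrete, so the continuity condition is empty.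
  refine regAt_generate (t := ⊤) (@Continuous.continuousAt _ _ _ ⊤ _ _ continuous_top) ?_
  intro g hg
  induction hg using Algebra.adjoin_induction with
  | mem g hg =>
    obtain ⟨l, rfl⟩ := hg
    exact h l
  | algebraMap r => exact X.reg_const r x
  | add f g _ _ hf hg => exact X.reg_add hf hg
  | mul f g _ _ hf hg => exact X.reg_mul hf hg

theorem regAt_linear (L : V →ₗ[ℝ] W) (v : V) : RegAt (affine V) (affine W) (fun v => L v) v :=
  regAt_affine fun l => affine_reg (l.comp L) v

theorem regAt_affine_pi {X : RSpace} {n : ℕ} {f : X → Fin n → ℝ} {x : X}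
    (h : ∀ i, X.Reg (fun y => f y i) x) : RegAt X (affine (Fin n → ℝ)) f x := by
  refine regAt_affine fun l => ?_
  have e : (fun y => l (f y)) = fun y => ∑ i, f y i * l (Pi.single i 1) := by
    funext y
    conv_lhs => rw [← Finset.univ_sum_single (f y), map_sum]
    refine Finset.sum_congr rfl fun i _ => ?_
    rw [← smul_eq_mul, ← map_smul, ← Pi.single_smul, smul_eq_mul, mul_one]
  rw [e]
  exact reg_sum _ fun i _ => X.reg_mul (h i) (X.reg_const _ x)

theorem regAt_affine_complex {X : RSpace} {f : X → ℂ} {x : X} (h : X.RegC f x) :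
    RegAt X (affine ℂ) f x := by
  refine regAt_affine fun l => ?_
  have e : (fun y => l (f y)) = fun y => (f y).re * l 1 + (f y).im * l Complex.I := by
    funext y
    conv_lhs => rw [← Complex.re_add_im (f y)]
    rw [map_add, ← smul_eq_mul (a := ((f y).im : ℂ)), ← mul_one ((f y).re : ℂ),
      ← smul_eq_mul (a := ((f y).re : ℂ)), Complex.coe_smul, Complex.coe_smul, map_smul, map_smul]
    rfl
  rw [e]
  exact X.reg_add (X.reg_mul h.1 (X.reg_const _ x)) (X.reg_mul h.2 (X.reg_const _ x))

theorem regAt_affine_complex_pi {X : RSpace} {n : ℕ} {f : X → Fin n → ℂ} {x : X}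
    (h : ∀ i, X.RegC (fun y => f y i) x) : RegAt X (affine (Fin n → ℂ)) f x := by
  refine regAt_affine fun l => ?_
  have e : (fun y => l (f y)) = fun y => ∑ i, l.comp (LinearMap.single ℝ (fun _ => ℂ) i) (f y i) := by
    funext y
    conv_lhs => rw [← Finset.univ_sum_single (f y), map_sum]
    rfl
  rw [e]
  exact reg_sum _ fun i _ => (regAt_affine_complex (h i)).reg (affine_reg _ _)

theorem affine_regC (L : V →ₗ[ℝ] ℂ) (v : V) : (affine V).RegC (fun v => L v) v :=
  ⟨affine_reg (Complex.reLm.comp L) v, affine_reg (Complex.imLm.comp L) v⟩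

end affine

/-! ### Subspaces -/

section sub

variable {X Y : RSpace}

theorem regAt_val (S : Set X) (x : sub X S) : RegAt (sub X S) X Subtype.val x :=
  ⟨continuous_subtype_val.continuousAt, fun f hf => ⟨f, hf, Filter.Eventually.of_forall fun _ => rfl⟩⟩

/-- The universal property of the induced structure; representability of both functors rests on it.
-/
theorem regAt_sub {S : Set Y} {f : X → sub Y S} {x : X}
    (h : RegAt X Y (fun y => (f y).1) x) : RegAt X (sub Y S) f x := by
  have hc : ContinuousAt f x := Topology.IsInducing.subtypeVal.continuousAt_iff.2 h.1
  refine ⟨hc, ?_⟩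
  rintro g ⟨k, hk, hgk⟩
  refine X.reg_congr ?_ (h.reg hk)
  filter_upwards [hc.eventually hgk] with y hy
  exact hy.symm

end sub

/-! ### Products -/

section prod

variable {X Y Z : RSpace}

theorem regAt_fst (p : X × Y) : RegAt (prod X Y) X (fun z : X × Y => z.1) p := by
  refine ⟨?_, fun f hf => generate_reg (Algebra.subset_adjoin (Or.inl ⟨f, hf, rfl⟩))⟩
  refine continuousAt_def.2 fun U hU => ?_
  obtain ⟨W, hWU, hW, hx⟩ := mem_nhds_iff.1 hU
  exact mem_nhds_iff.2 ⟨_, Set.preimage_mono hWU, generate_isOpen (hW.preimage continuous_fst), hx⟩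

theorem regAt_snd (p : X × Y) : RegAt (prod X Y) Y (fun z : X × Y => z.2) p := by
  refine ⟨?_, fun f hf => generate_reg (Algebra.subset_adjoin (Or.inr ⟨f, hf, rfl⟩))⟩
  refine continuousAt_def.2 fun U hU => ?_
  obtain ⟨W, hWU, hW, hx⟩ := mem_nhds_iff.1 hU
  exact mem_nhds_iff.2 ⟨_, Set.preimage_mono hWU, generate_isOpen (hW.preimage continuous_snd), hx⟩

theorem regAt_prod {f : Z → X} {g : Z → Y} {z : Z} (hf : RegAt Z X f z) (hg : RegAt Z Y g z) :
    RegAt Z (prod X Y) (fun y => (f y, g y)) z := by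
  refine regAt_generate (hf.1.prodMk hg.1) ?_
  intro k hk
  induction hk using Algebra.adjoin_induction with
  | mem k hk =>
    rcases hk with ⟨k, hk, rfl⟩ | ⟨k, hk, rfl⟩
    · exact hf.reg hk
    · exact hg.reg hk
  | algebraMap r => exact Z.reg_const r z
  | add f g _ _ hf hg => exact Z.reg_add hf hg
  | mul f g _ _ hf hg => exact Z.reg_mul hf hg

end prod

/-! ### Projective spaces -/

theorem regAt_quotient (X : RSpace) {Y : Type} (φ : X → Y) (x : X) :
    RegAt X (quotient X φ) φ x := by
  refine ⟨?_, ?_⟩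
  · have h : Continuous[X.top, .coinduced φ X.top] φ := continuous_coinduced_rng
    exact @Continuous.continuousAt X Y X.top (.coinduced φ X.top) φ x h
  · rintro g ⟨U, hU, hx, h⟩
    exact h x hx

section projective

variable {K V : Type} [DivisionRing K] [AddCommGroup V] [Module K V] [Module ℝ V]

theorem regAt_mk {X : RSpace} {f : X → V} (h0 : ∀ y, f y ≠ 0) {x : X}
    (hf : RegAt X (affine V) f x) :
    RegAt X (projective K V) (fun y => Projectivization.mk K (f y) (h0 y)) x := by
  have h1 : RegAt X (sub (affine V) {v : V | v ≠ 0}) (fun y => ⟨f y, h0 y⟩) x := regAt_sub hf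
  exact RegAt.comp (Y := sub (affine V) {v : V | v ≠ 0}) (Z := projective K V)
    (g := fun v => Projectivization.mk K v.1 v.2) (f := fun y => ⟨f y, h0 y⟩) (regAt_quotient _ _ _) h1

/-- Non-vanishing of `D` is invariant under scaling, so the choice made by `rep` is harmless: the
preimage in `V ∖ {0}` is the non-vanishing locus of `D`. -/
theorem projective_isOpen {D : V → ℝ} (hD : ∀ v, (affine V).Reg D v)
    (hD0 : ∀ (a : K) (v : V), a ≠ 0 → D v ≠ 0 → D (a • v) ≠ 0) :
    IsOpen[(projective K V).top] {p : ℙ K V | D p.rep ≠ 0} := by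
  refine isOpen_coinduced.2 (isOpen_iff_mem_nhds.2 ?_)
  have key : ∀ v : {v : V // v ≠ 0}, D (Projectivization.mk K v.1 v.2).rep ≠ 0 ↔ D v.1 ≠ 0 := by
    intro v
    obtain ⟨a, ha⟩ := Projectivization.exists_smul_eq_mk_rep K v.1 v.2
    constructor
    · intro h
      have := hD0 (a⁻¹ : Kˣ) _ (Units.ne_zero _) h
      rwa [← ha, ← Units.smul_def, inv_smul_smul] at this
    · intro h
      rw [← ha]
      exact hD0 a v.1 a.ne_zero h
  intro v hv
  have h := (sub (affine V) {v : V | v ≠ 0}).reg_ne_zero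
    ((regAt_val (X := affine V) {v : V | v ≠ 0} v).reg (hD v.1)) ((key v).1 hv)
  filter_upwards [h] with w hw
  exact (key w).2 hw

/-- A function invariant under scaling pulls back to itself on `V ∖ {0}`, whichever representative
`rep` selects. The locus `D ≠ 0` serves as the neighbourhood on which regularity is tested. -/
theorem projective_reg {D f : V → ℝ} (hD : ∀ v, (affine V).Reg D v)
    (hD0 : ∀ (a : K) (v : V), a ≠ 0 → D v ≠ 0 → D (a • v) ≠ 0)
    (hf : ∀ v, D v ≠ 0 → (affine V).Reg f v)
    (hf0 : ∀ (a : K) (v : V), a ≠ 0 → v ≠ 0 → f (a • v) = f v) {p : ℙ K V} (hp : D p.rep ≠ 0) :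
    (projective K V).Reg (fun p : ℙ K V => f p.rep) p := by
  refine ⟨{p : ℙ K V | D p.rep ≠ 0}, projective_isOpen hD hD0, hp, ?_⟩
  intro v hv
  have e : (fun v : {v : V // v ≠ 0} => f (Projectivization.mk K v.1 v.2).rep) = fun v => f v.1 := by
    funext v
    obtain ⟨a, ha⟩ := Projectivization.exists_smul_eq_mk_rep K v.1 v.2
    rw [← ha]
    exact hf0 a v.1 a.ne_zero v.2
  obtain ⟨v, hv0⟩ : {v : V // v ≠ 0} := v
  obtain ⟨a, ha⟩ := Projectivization.exists_smul_eq_mk_rep K v hv0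
  have hv' : D v ≠ 0 := by
    have := hD0 (a⁻¹ : Kˣ) _ (Units.ne_zero _) hv
    rwa [← ha, ← Units.smul_def, inv_smul_smul] at this
  have := (regAt_val (X := affine V) {v : V | v ≠ 0} ⟨v, hv0⟩).reg (hf v hv')
  exact e ▸ this

end projective

/-! ## Separatedness -/

/-- Global regular functions separate the points of `X`. -/
def SeparatesPoints (X : RSpace) : Prop :=
  ∀ x y : X, x ≠ y → ∃ f : X → ℝ, (∀ z, X.Reg f z) ∧ f x ≠ f y

namespace SeparatesPoints

variable {X Y : RSpace}

/-- If `f` separates `x` and `y`, then `f p.1 - f p.2` is regular, nonzero at `(x, y)` and zero on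
the diagonal. The stronger property is used because it passes easily to products and subspaces. -/
theorem isClosed_diagonal (h : X.SeparatesPoints) :
    IsClosed {p : RSpace.prod X X | (show X × X from p).1 = (show X × X from p).2} := by
  refine isOpen_compl_iff.1 (isOpen_iff_mem_nhds.2 ?_)
  rintro ⟨x, y⟩ hxy
  obtain ⟨f, hf, hne⟩ := h x y hxy
  have h1 := reg_sub ((regAt_fst (X := X) (Y := X) (x, y)).reg (hf x))
    ((regAt_snd (X := X) (Y := X) (x, y)).reg (hf y))
  filter_upwards [(RSpace.prod X X).reg_ne_zero h1 (sub_ne_zero.2 hne)] with p hp h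
  exact sub_ne_zero.1 hp (congrArg f h)

theorem comap (h : Y.SeparatesPoints) (f : X → Y) (hf : ∀ x, RegAt X Y f x)
    (hi : Function.Injective f) : X.SeparatesPoints := fun x y hxy => by
  obtain ⟨g, hg, hne⟩ := h (f x) (f y) (hi.ne hxy)
  exact ⟨fun z => g (f z), fun z => (hf z).reg (hg _), hne⟩

theorem sub (h : X.SeparatesPoints) (S : Set X) : (RSpace.sub X S).SeparatesPoints :=
  h.comap _ (regAt_val S) Subtype.val_injective

theorem prod (hX : X.SeparatesPoints) (hY : Y.SeparatesPoints) :
    (RSpace.prod X Y).SeparatesPoints := by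
  rintro ⟨x, y⟩ ⟨x', y'⟩ hne
  by_cases hx : x = x'
  · have hy : y ≠ y' := by
      rintro rfl
      exact hne (by rw [hx])
    obtain ⟨f, hf, h⟩ := hY y y' hy
    exact ⟨_, fun z => (regAt_snd z).reg (hf _), h⟩
  · obtain ⟨f, hf, h⟩ := hX x x' hx
    exact ⟨_, fun z => (regAt_fst z).reg (hf _), h⟩

theorem affine (V : Type) [AddCommGroup V] [Module ℝ V] : (RSpace.affine V).SeparatesPoints := by
  intro (v : V) (w : V) hne
  by_contra! h
  refine hne (sub_eq_zero (a := v).1 ((Module.forall_dual_apply_eq_zero_iff ℝ (v - w)).1 fun l => ?_))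
  rw [map_sub, sub_eq_zero]
  exact h (fun u => l u) fun z => affine_reg l z

theorem quotient (h : X.SeparatesPoints) {Y : Type} {φ : X → Y} (hφ : Function.Bijective φ) :
    (RSpace.quotient X φ).SeparatesPoints := by
  intro (x : Y) (y : Y) hne
  obtain ⟨ψ, hl, hr⟩ := Function.bijective_iff_has_inverse.1 hφ
  obtain ⟨f, hf, h⟩ := h (ψ x) (ψ y) (hr.injective.ne hne)
  refine ⟨fun z => f (ψ z), fun z => ⟨Set.univ,
    @isOpen_univ Y (.coinduced φ X.top), trivial, fun x _ => ?_⟩, h⟩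
  exact X.reg_congr (Filter.Eventually.of_forall fun x' =>
    (congrArg f (hl x')).symm) (hf x)

end SeparatesPoints

section

variable {K : Type} [RCLike K] {n : ℕ}

theorem affine_reg_normSq (l : (Fin n → K) →ₗ[K] K) (v : Fin n → K) :
    (affine (Fin n → K)).Reg (fun v => RCLike.normSq (l v)) v := by
  have h1 := affine_reg ((RCLike.reLm (K := K)).comp (l.restrictScalars ℝ)) v
  have h2 := affine_reg ((RCLike.imLm (K := K)).comp (l.restrictScalars ℝ)) v
  have := (affine (Fin n → K)).reg_add ((affine (Fin n → K)).reg_mul h1 h1)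
    ((affine (Fin n → K)).reg_mul h2 h2)
  simpa [RCLike.normSq_apply, Function.comp_def] using this

/-- A linear form `l` that vanishes at `q` but not at `p` gives the function `|l v|² / ∑ |vᵢ|²`. It
has degree zero, and its denominator has no zero on `V ∖ {0}`, so it is regular everywhere. -/
theorem SeparatesPoints.projective : (RSpace.projective K (Fin n → K)).SeparatesPoints := by
  intro (p : ℙ K (Fin n → K)) (q : ℙ K (Fin n → K)) hpq
  have hnorm : ∀ v : Fin n → K, v ≠ 0 → ∑ i, RCLike.normSq (v i) ≠ 0 := by
    intro v hv h
    rw [Finset.sum_eq_zero_iff_of_nonneg fun i _ => RCLike.normSq_nonneg _] at h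
    exact hv (funext fun i => RCLike.normSq_eq_zero.1 (h i (Finset.mem_univ i)))
  -- If all `2 × 2` minors vanished, the two representatives would be proportional.
  obtain ⟨i, j, hij⟩ : ∃ i j, p.rep i * q.rep j - p.rep j * q.rep i ≠ 0 := by
    by_contra! h
    obtain ⟨j, hj⟩ := Function.ne_iff.1 q.rep_nonzero
    have hpj : p.rep j ≠ 0 := by
      intro h0
      refine p.rep_nonzero (funext fun i => ?_)
      have := h i j
      rw [h0, zero_mul, sub_zero] at this
      exact (mul_eq_zero.1 this).resolve_right hj
    refine hpq (show @Eq (ℙ K (Fin n → K)) p q from ?_)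
    rw [← p.mk_rep, ← q.mk_rep, Projectivization.mk_eq_mk_iff']
    refine ⟨p.rep j / q.rep j, funext fun i => ?_⟩
    have := sub_eq_zero.1 (h i j)
    simp only [Pi.smul_apply, smul_eq_mul]
    rw [div_mul_eq_mul_div, ← this, mul_div_cancel_right₀ _ hj]
  let l : (Fin n → K) →ₗ[K] K :=
    q.rep j • LinearMap.proj i - q.rep i • LinearMap.proj j
  have hD : ∀ v, (RSpace.affine (Fin n → K)).Reg (fun v => ∑ i, RCLike.normSq (v i)) v := fun v =>
    reg_sum _ fun i _ => affine_reg_normSq (LinearMap.proj i) v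
  have hD0 : ∀ (a : K) (v : Fin n → K), ∑ i, RCLike.normSq ((a • v) i) =
      RCLike.normSq a * ∑ i, RCLike.normSq (v i) := by
    intro a v
    simp [Finset.mul_sum]
  refine ⟨fun p => RCLike.normSq (l (Projectivization.rep p)) /
      ∑ i, RCLike.normSq (Projectivization.rep p i), fun z => ?_, ?_⟩
  · refine projective_reg (K := K) (D := fun v => ∑ i, RCLike.normSq (v i))
      (f := fun v => RCLike.normSq (l v) / ∑ i, RCLike.normSq (v i)) hD ?_ ?_ ?_ ?_
    · intro a v ha hv
      rw [hD0]
      exact mul_ne_zero (RCLike.normSq_eq_zero.not.2 ha) hv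
    · intro v hv
      exact reg_div (affine_reg_normSq l v) (hD v) hv
    · intro a v ha hv
      simp only [hD0, map_smul, smul_eq_mul, map_mul]
      exact mul_div_mul_left _ _ (RCLike.normSq_eq_zero.not.2 ha)
    · exact hnorm _ (Projectivization.rep_nonzero z)
  · have hp : l p.rep ≠ 0 := by
      simpa [l, mul_comm] using hij
    have hq : l q.rep = 0 := by
      simp [l, mul_comm]
    simp only [hq, map_zero, zero_div]
    exact div_ne_zero (RCLike.normSq_eq_zero.not.2 hp) (hnorm _ p.rep_nonzero)

end

/-! ## Charts -/

/-- The coordinates `ψ` need to be regular only as functions on the ambient open set `U`, and to be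
inverse to `φ` only on `S ∩ U`; restriction to `S` does the rest. -/
theorem isSmoothAffine_of_chart {Ω : RSpace} {S U : Set Ω} {n : ℕ} (q : MvPolynomial (Fin n) ℝ)
    (φ : (Fin n → ℝ) → Ω) (ψ : Ω → Fin n → ℝ)
    (hφ : ∀ x, MvPolynomial.eval x q ≠ 0 → RegAt (affine (Fin n → ℝ)) Ω φ x)
    (hφS : ∀ x, MvPolynomial.eval x q ≠ 0 → φ x ∈ S)
    (hφU : ∀ x, MvPolynomial.eval x q ≠ 0 → φ x ∈ U)
    (hψ : ∀ ω ∈ U, ∀ j, Ω.Reg (fun ω => ψ ω j) ω)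
    (hψq : ∀ ω ∈ S, ω ∈ U → MvPolynomial.eval (ψ ω) q ≠ 0)
    (hψφ : ∀ x, MvPolynomial.eval x q ≠ 0 → ψ (φ x) = x)
    (hφψ : ∀ ω ∈ S, ω ∈ U → φ (ψ ω) = ω) :
    IsSmoothAffine (sub (sub Ω S) (Subtype.val ⁻¹' U)) := by
  -- There are no equations, so the independence of gradients is vacuous.
  refine ⟨n, 0, Fin.elim0, q, fun x _ => linearIndependent_empty_type, ⟨?_⟩⟩
  let f : sub (sub Ω S) (Subtype.val ⁻¹' U) → sub (affine (Fin n → ℝ)) (locus Fin.elim0 q) :=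
    fun ω => ⟨ψ ω.1.1, fun i => i.elim0, hψq _ ω.1.2 ω.2⟩
  let g : sub (affine (Fin n → ℝ)) (locus Fin.elim0 q) → sub (sub Ω S) (Subtype.val ⁻¹' U) :=
    fun x => ⟨⟨φ x.1, hφS _ x.2.2⟩, hφU _ x.2.2⟩
  have hf : ∀ ω, RegAt (sub (sub Ω S) (Subtype.val ⁻¹' U)) _ f ω := fun ω =>
    regAt_sub (regAt_affine_pi fun j =>
      (RegAt.comp (regAt_val S _) (regAt_val (Subtype.val ⁻¹' U) ω)).reg (hψ _ ω.2 j))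
  have hg : ∀ x, RegAt (sub (affine (Fin n → ℝ)) (locus Fin.elim0 q)) _ g x := fun x =>
    regAt_sub (regAt_sub (RegAt.comp (X := sub (affine (Fin n → ℝ)) (locus Fin.elim0 q))
      (Y := affine (Fin n → ℝ)) (g := φ) (hφ _ x.2.2) (regAt_val _ x)))
  refine ⟨RegAt.hom f hf, RegAt.hom g hg, Hom.ext (funext fun ω => ?_), Hom.ext (funext fun x => ?_)⟩
  · exact Subtype.ext (Subtype.ext (hφψ _ ω.1.2 ω.2))
  · exact Subtype.ext (hψφ _ x.2.2)

theorem isSmoothVariety_of_charts {Ω : RSpace} {S : Set Ω} (hsep : Ω.SeparatesPoints) {ι : Type}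
    [Finite ι] (U : ι → Set Ω) (hU : ∀ i, IsOpen (U i)) (hS : ∀ ω ∈ S, ∃ i, ω ∈ U i)
    (h : ∀ i, IsSmoothAffine (sub (sub Ω S) (Subtype.val ⁻¹' U i))) :
    (Ω.sub S).IsSmoothVariety := by
  obtain ⟨m, ⟨e⟩⟩ := Finite.exists_equiv_fin ι
  refine ⟨(hsep.sub S).isClosed_diagonal, m, fun k => Subtype.val ⁻¹' U (e.symm k),
    fun k => (hU _).preimage continuous_subtype_val, fun ω => ?_, fun k => h _⟩
  obtain ⟨i, hi⟩ := hS ω.1 ω.2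
  exact ⟨e i, show ω.1 ∈ U (e.symm (e i)) by rwa [e.symm_apply_apply]⟩

end RSpace

/-! ## Fine moduli spaces -/

open RSpace in
-- A family and its classifying morphism have the same underlying map of points, which is why both
-- inverse laws and naturality hold by `rfl`.
theorem isFineModuliSpace_tautologicalFamily {Ω : RSpace} {S : Set Ω}
    (h : (Ω.sub S).IsSmoothVariety) :
    IsFineModuliSpace (familyFunctor Ω S) ⟨Ω.sub S, h⟩ (tautologicalFamily Ω S h) := by
  let M : SmoothVar := ⟨Ω.sub S, h⟩
  let e : ∀ B : SmoothVar, (B ⟶ M) ≃ (familyFunctor Ω S).obj (op B) := fun B =>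
    { toFun := fun m => (familyFunctor Ω S).map m.op (tautologicalFamily Ω S h)
      invFun := fun f => ⟨RegAt.hom (Y := Ω.sub S) (fun b => ⟨onPoints f.1 b, f.2 b⟩) fun b =>
        regAt_sub ⟨f.1.continuous_toFun.continuousAt, f.1.reg_comp b⟩⟩
      left_inv := fun m => rfl
      right_inv := fun f => rfl }
  let R : (familyFunctor Ω S).RepresentableBy M :=
    { homEquiv := fun {B} => e B
      homEquiv_comp := fun f g => rfl }
  refine ⟨R, rfl, fun B f => ?_, fun E Ψ => ?_⟩
  · exact ⟨(e B).symm f, (e B).apply_symm_apply f, fun m hm => (e B).injective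
      (hm.trans ((e B).apply_symm_apply f).symm)⟩
  -- The transformation `Φ` is forced, since `R.toIso` is invertible.
  · refine ⟨R.toIso.hom ≫ Ψ, by simp, fun Φ hΦ => ?_⟩
    rw [← hΦ]
    simp

/-! ## Arguments modulo `π` -/

/-- Congruence modulo `2π` implies congruence modulo `π`; this transfers the identities known for
`Real.Angle`. -/
theorem coe_addCircle_pi_eq_of_angle_eq {a b : ℝ} (h : (a : Real.Angle) = b) :
    (a : AddCircle Real.pi) = b := by
  rw [Real.Angle.angle_eq_iff_two_pi_dvd_sub] at h
  obtain ⟨k, hk⟩ := h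
  refine QuotientAddGroup.eq_iff_sub_mem.2 (AddSubgroup.mem_zmultiples_iff.2 ⟨2 * k, ?_⟩)
  simp only [zsmul_eq_mul, Int.cast_mul, Int.cast_ofNat]
  linarith

theorem argModPi_mul {z w : ℂ} (hz : z ≠ 0) (hw : w ≠ 0) :
    argModPi (z * w) = argModPi z + argModPi w := by
  have h := Complex.arg_mul_coe_angle hz hw
  rw [← Real.Angle.coe_add] at h
  exact (coe_addCircle_pi_eq_of_angle_eq h).trans (AddCircle.coe_add ..)

theorem argModPi_one : argModPi 1 = 0 := by
  simp [argModPi]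

/-- The product of `z` and its conjugate is a nonzero real number, whose argument is `0` modulo `π`.
-/
theorem argModPi_conj {z : ℂ} (hz : z ≠ 0) :
    argModPi ((starRingEnd ℂ) z) = -argModPi z := by
  have h : argModPi (z * (starRingEnd ℂ) z) = 0 := by
    rw [Complex.mul_conj, ← mul_one ((Complex.normSq z : ℝ) : ℂ),
      argModPi_real_mul _ (by simpa using hz), argModPi_one]
  rw [argModPi_mul hz (by simpa using hz)] at h
  exact (neg_eq_of_add_eq_zero_right h).symm

theorem argModPi_mul_conj {z w : ℂ} (hz : z ≠ 0) (hw : w ≠ 0) :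
    argModPi (z * (starRingEnd ℂ) w) = argModPi z - argModPi w := by
  rw [argModPi_mul hz (by simpa using hw), argModPi_conj hw, sub_eq_add_neg]

theorem argModPi_div {z w : ℂ} (hz : z ≠ 0) (hw : w ≠ 0) :
    argModPi (z / w) = argModPi z - argModPi w := by
  rw [eq_sub_iff_add_eq, ← argModPi_mul (div_ne_zero hz hw) hw, div_mul_cancel₀ _ hw]

theorem exists_real_mul_of_argModPi_eq_zero {z : ℂ} (h : argModPi z = 0) : ∃ t : ℝ, z = t := by
  obtain ⟨k, hk⟩ := AddSubgroup.mem_zmultiples_iff.1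
    ((QuotientAddGroup.eq_zero_iff (N := AddSubgroup.zmultiples Real.pi) _).1 h)
  refine ⟨z.re, Complex.ext (by simp) ?_⟩
  have := Complex.norm_mul_sin_arg z
  rw [← this, ← hk, zsmul_eq_mul, Real.sin_int_mul_pi]
  simp

theorem exists_real_mul_of_argModPi_eq {z w : ℂ} (hz : z ≠ 0) (hw : w ≠ 0)
    (h : argModPi z = argModPi w) : ∃ t : ℝ, z = t * w := by
  obtain ⟨t, ht⟩ := exists_real_mul_of_argModPi_eq_zero (z := z / w)
    (by rw [argModPi_div hz hw, h, sub_self])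
  exact ⟨t, by rw [← ht, div_mul_cancel₀ _ hw]⟩

theorem exists_argModPi_eq (ξ : AddCircle Real.pi) : ∃ z : ℂ, z ≠ 0 ∧ argModPi z = ξ := by
  induction ξ using QuotientAddGroup.induction_on with
  | H θ =>
    refine ⟨Complex.exp (θ * Complex.I), Complex.exp_ne_zero _, ?_⟩
    exact coe_addCircle_pi_eq_of_angle_eq (by
      simpa [Complex.exp_mul_I] using Complex.arg_cos_add_sin_mul_I_coe_angle θ)

/-- A nonzero vector with the given argument modulo `π`. -/
noncomputable def dirRep (ξ : AddCircle Real.pi) : ℂ := (exists_argModPi_eq ξ).choose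

theorem dirRep_ne_zero (ξ : AddCircle Real.pi) : dirRep ξ ≠ 0 := (exists_argModPi_eq ξ).choose_spec.1

theorem argModPi_dirRep (ξ : AddCircle Real.pi) : argModPi (dirRep ξ) = ξ :=
  (exists_argModPi_eq ξ).choose_spec.2

/-- The chosen vector is known only up to a nonzero real factor, so expressions in `dirRep` are
meaningful when they are invariant under such factors. -/
theorem exists_dirRep_argModPi {z : ℂ} (hz : z ≠ 0) :
    ∃ t : ℝ, t ≠ 0 ∧ dirRep (argModPi z) = t * z := by
  obtain ⟨t, ht⟩ := exists_real_mul_of_argModPi_eq (dirRep_ne_zero _) hz (argModPi_dirRep _)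
  refine ⟨t, ?_, ht⟩
  rintro rfl
  exact dirRep_ne_zero _ (by rw [ht]; simp)

/-! ## The circle `ℝ/π` as a variety -/

/-- The complex number with given real and imaginary part. -/
def vecToComplex : (Fin 2 → ℝ) →ₗ[ℝ] ℂ where
  toFun v := ⟨v 0, v 1⟩
  map_add' v w := by apply Complex.ext <;> simp
  map_smul' t v := by apply Complex.ext <;> simp

theorem vecToComplex_ne_zero {v : Fin 2 → ℝ} (hv : v ≠ 0) : vecToComplex v ≠ 0 := by
  refine fun h => hv (funext fun i => ?_)
  fin_cases i
  · exact congrArg Complex.re h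
  · exact congrArg Complex.im h

theorem rho_eq (p : ℙ ℝ (Fin 2 → ℝ)) : rho p = argModPi (vecToComplex p.rep) := by
  conv_lhs => rw [← p.mk_rep]
  rfl

theorem rho_bijective : Function.Bijective rho := by
  constructor
  · intro p q h
    rw [rho_eq, rho_eq] at h
    obtain ⟨t, ht⟩ := exists_real_mul_of_argModPi_eq (vecToComplex_ne_zero p.rep_nonzero)
      (vecToComplex_ne_zero q.rep_nonzero) h
    rw [← p.mk_rep, ← q.mk_rep, Projectivization.mk_eq_mk_iff']
    refine ⟨t, funext fun i => ?_⟩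
    fin_cases i
    · simpa [vecToComplex] using (congrArg Complex.re ht).symm
    · simpa [vecToComplex] using (congrArg Complex.im ht).symm
  · intro ξ
    obtain ⟨z, hz, rfl⟩ := exists_argModPi_eq ξ
    have h0 : (![z.re, z.im] : Fin 2 → ℝ) ≠ 0 := fun h =>
      hz (Complex.ext (congrFun h 0) (congrFun h 1))
    exact ⟨Projectivization.mk ℝ _ h0, rfl⟩

open RSpace

theorem circle_separatesPoints : circle.SeparatesPoints :=
  SeparatesPoints.projective.quotient rho_bijective

section

variable {D f : ℂ → ℝ} (hD : ∀ z, (affine ℂ).Reg D z)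
  (hD0 : ∀ (t : ℝ) (z : ℂ), t ≠ 0 → D z ≠ 0 → D (t * z) ≠ 0)
include hD hD0

/-- This and `circle_reg` carry the corresponding facts on `ℙ¹(ℝ)` along `rho`: the vectors `dirRep
(rho p)` and `p.rep` differ by a real factor, which the hypotheses on `D` and `f` absorb. -/
theorem circle_isOpen : IsOpen[circle.top] {ξ : AddCircle Real.pi | D (dirRep ξ) ≠ 0} := by
  refine isOpen_coinduced.2 ?_
  have h := projective_isOpen (K := ℝ) (V := Fin 2 → ℝ) (D := fun v => D (vecToComplex v))
    (fun v => (regAt_linear vecToComplex v).reg (hD _)) (fun a v ha hv => by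
      rw [map_smul, ← Complex.coe_smul]; exact hD0 a _ ha hv)
  convert h using 1
  refine Set.ext fun (p : ℙ ℝ (Fin 2 → ℝ)) => ?_
  change D (dirRep (rho p)) ≠ 0 ↔ D (vecToComplex (Projectivization.rep p)) ≠ 0
  rw [rho_eq]
  obtain ⟨t, ht, e⟩ := exists_dirRep_argModPi (vecToComplex_ne_zero (Projectivization.rep_nonzero p))
  rw [e]
  refine ⟨fun h => ?_, hD0 t _ ht⟩
  have := hD0 t⁻¹ _ (inv_ne_zero ht) h
  rwa [← mul_assoc, ← Complex.ofReal_mul, inv_mul_cancel₀ ht, Complex.ofReal_one, one_mul] at this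

theorem circle_reg (hf : ∀ z, D z ≠ 0 → (affine ℂ).Reg f z)
    (hf0 : ∀ (t : ℝ) (z : ℂ), t ≠ 0 → z ≠ 0 → f (t * z) = f z) {ξ : AddCircle Real.pi}
    (hξ : D (dirRep ξ) ≠ 0) :
    circle.Reg (fun ξ : AddCircle Real.pi => f (dirRep ξ)) ξ := by
  refine ⟨{ξ : AddCircle Real.pi | D (dirRep ξ) ≠ 0}, circle_isOpen hD hD0, hξ, ?_⟩
  intro (p : ℙ ℝ (Fin 2 → ℝ)) hp
  obtain ⟨t, ht, e⟩ := exists_dirRep_argModPi (vecToComplex_ne_zero p.rep_nonzero)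
  have hp' : D (vecToComplex p.rep) ≠ 0 := by
    have hp : D (dirRep (rho p)) ≠ 0 := hp
    rw [rho_eq, e] at hp
    have := hD0 t⁻¹ _ (inv_ne_zero ht) hp
    rwa [← mul_assoc, ← Complex.ofReal_mul, inv_mul_cancel₀ ht, Complex.ofReal_one, one_mul] at this
  have h := projective_reg (K := ℝ) (V := Fin 2 → ℝ) (D := fun v => D (vecToComplex v))
    (f := fun v => f (vecToComplex v))
    (fun v => (regAt_linear vecToComplex v).reg (hD _)) (fun a v ha hv => by
      rw [map_smul, ← Complex.coe_smul]; exact hD0 a _ ha hv)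
    (fun v hv => (regAt_linear vecToComplex v).reg (hf _ hv))
    (fun a v ha hv => by
      rw [map_smul, ← Complex.coe_smul]; exact hf0 a _ ha (vecToComplex_ne_zero hv)) hp'
  refine RSpace.reg_congr _ (Filter.Eventually.of_forall fun (q : ℙ ℝ (Fin 2 → ℝ)) => ?_) h
  change f (vecToComplex (Projectivization.rep q)) = f (dirRep (rho q))
  rw [rho_eq]
  obtain ⟨t, ht, e⟩ := exists_dirRep_argModPi (vecToComplex_ne_zero (Projectivization.rep_nonzero q))
  rw [e, hf0 t _ ht (vecToComplex_ne_zero (Projectivization.rep_nonzero q))]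

end

/-- Near `x` the map is the composite of `y ↦ [re (f y), im (f y)]` with `rho`. -/
theorem regAt_argModPi {X : RSpace} {f : X → ℂ} {x : X} (hf : X.RegC f x) (h0 : f x ≠ 0) :
    RegAt X circle (fun y => argModPi (f y)) x := by
  classical
  -- `regAt_mk` requires a map without zeros, so the zeros of `f`, which stay away from `x`, are
  -- replaced by `1`.
  let g : X → ℂ := fun y => if f y = 0 then 1 else f y
  have hfg : ∀ᶠ y in 𝓝 x, f y = g y := (hf.eventually_ne h0).mono fun y hy => (if_neg hy).symm
  have hg0 : ∀ y, g y ≠ 0 := fun y => by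
    by_cases h : f y = 0 <;> simp [g, h]
  have h1 : RegAt X (RSpace.projective ℝ (Fin 2 → ℝ))
      (fun y => Projectivization.mk ℝ ![(g y).re, (g y).im] fun h =>
        hg0 y (Complex.ext (congrFun h 0) (congrFun h 1))) x := by
    refine regAt_mk _ (regAt_affine_pi fun i => ?_)
    fin_cases i
    · exact X.reg_congr (hfg.mono fun y hy => by rw [hy]; rfl) hf.1
    · exact X.reg_congr (hfg.mono fun y hy => by rw [hy]; rfl) hf.2
  have h2 : RegAt X circle (fun y => argModPi (g y)) x :=
    RegAt.comp (Z := circle) (g := rho) (regAt_quotient _ _ _) h1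
  exact h2.congr (hfg.mono fun y hy => congrArg argModPi hy.symm)

/-! ### Slopes -/

/-- The vector of slope `m` with respect to the orthogonal basis `e, ie` of `ℂ`. -/
noncomputable def slopeVec (e : ℂ) (m : ℝ) : ℂ := e * (1 + m * Complex.I)

theorem slopeVec_div {e : ℂ} (he : e ≠ 0) (m : ℝ) : slopeVec e m / e = 1 + m * Complex.I :=
  mul_div_cancel_left₀ _ he

theorem slopeVec_ne_zero {e : ℂ} (he : e ≠ 0) (m : ℝ) : slopeVec e m ≠ 0 :=
  mul_ne_zero he fun h => by simpa using congrArg Complex.re h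

theorem eq_re_mul_slopeVec {e z : ℂ} (he : e ≠ 0) (hz : (z / e).re ≠ 0) :
    z = (z / e).re * slopeVec e ((z / e).im / (z / e).re) := by
  have h : ((z / e).re : ℂ) ≠ 0 := by exact_mod_cast hz
  conv_lhs => rw [← mul_div_cancel₀ z he, ← Complex.re_add_im (z / e)]
  rw [slopeVec, Complex.ofReal_div]
  field_simp

theorem RSpace.RegC.slopeVec {X : RSpace} {f : X → ℝ} {x : X} (e : ℂ) (hf : X.Reg f x) :
    X.RegC (fun y => slopeVec e (f y)) x :=
  (RegC.const e x).mul ((RegC.const 1 x).add ((RegC.ofReal hf).mul (RegC.const Complex.I x)))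

/-- The slope of a direction with respect to the orthogonal basis `e, ie` of `ℂ`. -/
noncomputable def slope (e : ℂ) (ξ : AddCircle Real.pi) : ℝ :=
  (dirRep ξ / e).im / (dirRep ξ / e).re

/-- The directions that are not orthogonal to `e`. -/
def slopeDomain (e : ℂ) : Set (AddCircle Real.pi) := {ξ | (dirRep ξ / e).re ≠ 0}

theorem affine_regC_div (e z : ℂ) : (affine ℂ).RegC (fun z : ℂ => z / e) z := by
  simp only [div_eq_mul_inv]
  exact (affine_regC LinearMap.id z).mul (RegC.const (X := affine ℂ) e⁻¹ z)

theorem ofReal_mul_div_re (e z : ℂ) (t : ℝ) : ((t * z : ℂ) / e).re = t * (z / e).re := by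
  rw [mul_div_assoc, Complex.re_ofReal_mul]

theorem ofReal_mul_div_im (e z : ℂ) (t : ℝ) : ((t * z : ℂ) / e).im = t * (z / e).im := by
  rw [mul_div_assoc, Complex.im_ofReal_mul]

theorem isOpen_slopeDomain (e : ℂ) : IsOpen[circle.top] (slopeDomain e) :=
  circle_isOpen (D := fun z => (z / e).re) (fun z => (affine_regC_div e z).1) fun t z ht hz => by
    rw [ofReal_mul_div_re]
    exact mul_ne_zero ht hz

theorem circle_reg_slope {e : ℂ} {ξ : AddCircle Real.pi} (hξ : ξ ∈ slopeDomain e) :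
    circle.Reg (slope e) ξ :=
  circle_reg (D := fun z => (z / e).re) (f := fun z => (z / e).im / (z / e).re)
    (fun z => (affine_regC_div e z).1)
    (fun t z ht hz => by
      rw [ofReal_mul_div_re]
      exact mul_ne_zero ht hz)
    (fun z hz => reg_div (affine_regC_div e z).2 (affine_regC_div e z).1 hz)
    (fun t z ht hz => by
      rw [ofReal_mul_div_re, ofReal_mul_div_im, mul_div_mul_left _ _ ht])
    hξ

/-- Together with the next two lemmas: `m ↦ argModPi (slopeVec e m)` and `slope e` are inverse
bijections between `ℝ` and `slopeDomain e`, the affine charts of the circle. -/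
theorem argModPi_slopeVec_slope {e : ℂ} (he : e ≠ 0) {ξ : AddCircle Real.pi}
    (hξ : ξ ∈ slopeDomain e) : argModPi (slopeVec e (slope e ξ)) = ξ := by
  rw [← argModPi_real_mul _ hξ, slope, ← eq_re_mul_slopeVec he hξ, argModPi_dirRep]

theorem argModPi_slopeVec_mem {e : ℂ} (he : e ≠ 0) (m : ℝ) :
    argModPi (slopeVec e m) ∈ slopeDomain e := by
  obtain ⟨t, ht, h⟩ := exists_dirRep_argModPi (slopeVec_ne_zero he m)
  change (dirRep _ / e).re ≠ 0
  rw [h, ofReal_mul_div_re, slopeVec_div he]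
  simpa using ht

theorem slope_argModPi_slopeVec {e : ℂ} (he : e ≠ 0) (m : ℝ) :
    slope e (argModPi (slopeVec e m)) = m := by
  obtain ⟨t, ht, h⟩ := exists_dirRep_argModPi (slopeVec_ne_zero he m)
  rw [slope, h, ofReal_mul_div_re, ofReal_mul_div_im, slopeVec_div he, mul_div_mul_left _ _ ht]
  simp

/-- For `z ≠ 0` both sides have direction `ξ` and the same component along `e`; for `z = 0` the
factor is zero while the slope of `ξ` stays free. This is the blow-up coordinate that handles a
vanishing side. -/
theorem eq_re_mul_slopeVec_slope {e : ℂ} (he : e ≠ 0) {ξ : AddCircle Real.pi}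
    (hξ : ξ ∈ slopeDomain e) {z : ℂ} (hz : z ≠ 0 → ξ = argModPi z) :
    z = (z / e).re * slopeVec e (slope e ξ) := by
  by_cases h0 : z = 0
  · simp [h0]
  obtain ⟨t, ht⟩ := exists_real_mul_of_argModPi_eq h0 (slopeVec_ne_zero he (slope e ξ))
    (by rw [argModPi_slopeVec_slope he hξ, hz h0])
  have : (z / e).re = t := by
    rw [ht, ofReal_mul_div_re, slopeVec_div he]
    simp
  rw [this]
  exact ht

/-- One of the two axes of `ℂ`. -/
def axis (b : Bool) : ℂ := bif b then 1 else Complex.I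

theorem axis_ne_zero (b : Bool) : axis b ≠ 0 := by
  cases b <;> simp [axis]

theorem exists_div_axis_re_ne_zero {z : ℂ} (hz : z ≠ 0) : ∃ b, (z / axis b).re ≠ 0 := by
  by_contra! h
  have h1 := h true
  have h2 := h false
  simp only [axis, cond_true, cond_false, div_one, Complex.div_I, Complex.neg_re, Complex.mul_re,
    Complex.I_re, Complex.I_im, mul_zero, mul_one, zero_sub, neg_neg] at h1 h2
  exact hz (Complex.ext h1 h2)

theorem exists_mem_slopeDomain_axis (ξ : AddCircle Real.pi) : ∃ b, ξ ∈ slopeDomain (axis b) :=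
  exists_div_axis_re_ne_zero (dirRep_ne_zero ξ)

/-! ### Triples of directions -/

/-- The components of a triple. -/
def coord3 (ξ : AddCircle Real.pi × AddCircle Real.pi × AddCircle Real.pi) :
    Fin 3 → AddCircle Real.pi := ![ξ.1, ξ.2.1, ξ.2.2]

theorem regAt_coord3 (l : Fin 3) (ξ : AddCircle Real.pi × AddCircle Real.pi × AddCircle Real.pi) :
    RegAt circle3 circle (fun ξ => coord3 ξ l) ξ := by
  have h1 := regAt_fst (X := circle) (Y := circle.prod circle) ξ
  have h2 := regAt_snd (X := circle) (Y := circle.prod circle) ξ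
  fin_cases l
  · exact h1
  · exact (regAt_fst (X := circle) (Y := circle) ξ.2).comp h2
  · exact (regAt_snd (X := circle) (Y := circle) ξ.2).comp h2

theorem regAt_circle3 {X : RSpace} {f : Fin 3 → X → AddCircle Real.pi} {x : X}
    (h : ∀ l, RegAt X circle (f l) x) :
    RegAt X circle3 (fun y => (f 0 y, f 1 y, f 2 y)) x :=
  regAt_prod (h 0) (regAt_prod (h 1) (h 2))

theorem circle3_separatesPoints : circle3.SeparatesPoints :=
  circle_separatesPoints.prod (circle_separatesPoints.prod circle_separatesPoints)

/-! ## Side vectors -/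

/-- Sides are indexed cyclically from `i`, so that one chart formula serves all three choices of the
possibly vanishing side. -/
theorem fin3_cases (i l : Fin 3) : l = i ∨ l = i + 1 ∨ l = i + 2 := by
  revert i l; decide

theorem fin3_add_one_add_one (i : Fin 3) : i + 1 + 1 = i + 2 := by revert i; decide

theorem fin3_add_one_add_two (i : Fin 3) : i + 1 + 2 = i := by revert i; decide

theorem fin3_add_two_add_one (i : Fin 3) : i + 2 + 1 = i := by revert i; decide

theorem fin3_add_two_add_two (i : Fin 3) : i + 2 + 2 = i + 1 := by revert i; decide

theorem fin3_sum {M : Type*} [AddCommMonoid M] (f : Fin 3 → M) (i : Fin 3) :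
    f i + f (i + 1) + f (i + 2) = f 0 + f 1 + f 2 := by
  fin_cases i
  · rfl
  · change f 1 + f 2 + f 0 = _
    abel
  · change f 2 + f 0 + f 1 = _
    abel

/-- The triple with entries `a, b, c` in positions `i, i + 1, i + 2`. -/
def cyc {M : Type*} (i : Fin 3) (a b c : M) (l : Fin 3) : M :=
  if l = i then a else if l = i + 1 then b else c

section cyc

variable {M : Type*} (i : Fin 3) (a b c : M)

@[simp] theorem cyc_zero : cyc i a b c i = a := by simp [cyc]

@[simp] theorem cyc_one : cyc i a b c (i + 1) = b := by
  revert i; simp [cyc]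

@[simp] theorem cyc_two : cyc i a b c (i + 2) = c := by
  have h1 : i + 2 ≠ i := by revert i; decide
  have h2 : i + 2 ≠ i + 1 := by revert i; decide
  simp [cyc, h1, h2]

theorem eq_cyc {f : Fin 3 → M} (h0 : f i = a) (h1 : f (i + 1) = b) (h2 : f (i + 2) = c) :
    f = cyc i a b c := by
  funext l
  rcases fin3_cases i l with rfl | rfl | rfl <;> simp [*]

theorem cyc_sum {M : Type*} [AddCommMonoid M] (i : Fin 3) (a b c : M) :
    cyc i a b c 0 + cyc i a b c 1 + cyc i a b c 2 = a + b + c := by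
  simp [← fin3_sum _ i]

theorem RSpace.RegC.cyc {X : RSpace} {f g h : X → ℂ} {x : X} (hf : X.RegC f x) (hg : X.RegC g x)
    (hh : X.RegC h x) (i l : Fin 3) : X.RegC (fun y => cyc i (f y) (g y) (h y) l) x := by
  rcases fin3_cases i l with rfl | rfl | rfl <;> simpa

end cyc

theorem complexCoords_realCoords (w : Fin 3 → ℂ) : complexCoords (realCoords w) = w := by
  funext l; fin_cases l <;> rfl

theorem realCoords_complexCoords (v : Fin 6 → ℝ) : realCoords (complexCoords v) = v := by
  funext l; fin_cases l <;> rfl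

theorem complexCoords_smul (t : ℝ) (v : Fin 6 → ℝ) :
    complexCoords (t • v) = (t : ℂ) • complexCoords v := by
  funext l; fin_cases l <;> apply Complex.ext <;> simp [complexCoords]

theorem complexCoords_add (v w : Fin 6 → ℝ) :
    complexCoords (v + w) = complexCoords v + complexCoords w := by
  funext l; fin_cases l <;> apply Complex.ext <;> simp [complexCoords]

theorem realCoords_smul (t : ℝ) (w : Fin 3 → ℂ) :
    realCoords ((t : ℂ) • w) = t • realCoords w := by
  rw [← realCoords_complexCoords (t • realCoords w), complexCoords_smul, complexCoords_realCoords]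

theorem realCoords_ne_zero {w : Fin 3 → ℂ} (hw : w ≠ 0) : realCoords w ≠ 0 := fun h =>
  hw (by rw [← complexCoords_realCoords w, h]; funext l; fin_cases l <;> rfl)

theorem complexCoords_ne_zero {v : Fin 6 → ℝ} (hv : v ≠ 0) : complexCoords v ≠ 0 := fun h =>
  hv (by rw [← realCoords_complexCoords v, h]; funext l; fin_cases l <;> rfl)

theorem ne_zero_of_apply {w : Fin 3 → ℂ} {l : Fin 3} (h : w l ≠ 0) : w ≠ 0 := by
  rintro rfl
  exact h rfl

/-- A single nonzero component could not have sum zero with two zeros. Consequently at most one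
argument of a triangle is undetermined by its shape. -/
theorem exists_two_ne_zero {w : Fin 3 → ℂ} (hw : w ≠ 0) (hsum : w 0 + w 1 + w 2 = 0) :
    ∃ i : Fin 3, w (i + 1) ≠ 0 ∧ w (i + 2) ≠ 0 := by
  obtain ⟨j, hj⟩ := Function.ne_iff.1 hw
  rw [← fin3_sum w j] at hsum
  by_cases h1 : w (j + 1) = 0
  · refine ⟨j + 1, fun h2 => hj ?_, by rwa [fin3_add_one_add_two]⟩
    rw [fin3_add_one_add_one] at h2
    simpa [h1, h2] using hsum
  · exact ⟨j + 2, by rwa [fin3_add_two_add_one], by rwa [fin3_add_two_add_two]⟩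

/-- A component of `complexCoords`, as a linear map. -/
noncomputable def complexCoord (l : Fin 3) : (Fin 6 → ℝ) →ₗ[ℝ] ℂ where
  toFun v := complexCoords v l
  map_add' v w := by rw [complexCoords_add, Pi.add_apply]
  map_smul' t v := by rw [complexCoords_smul]; simp

theorem regAt_mk_realCoords {X : RSpace} {f : X → Fin 3 → ℂ} (h0 : ∀ y, f y ≠ 0) {x : X}
    (hf : ∀ l, X.RegC (fun y => f y l) x) :
    RegAt X (projective ℝ (Fin 6 → ℝ))
      (fun y => Projectivization.mk ℝ (realCoords (f y)) (realCoords_ne_zero (h0 y))) x := by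
  refine regAt_mk _ (regAt_affine_pi fun k => ?_)
  fin_cases k
  exacts [(hf 0).1, (hf 0).2, (hf 1).1, (hf 1).2, (hf 2).1, (hf 2).2]

/-- Triangles are the tuples `(B₀; t w; [w]; ξ)` with `w ≠ 0` and `t` real such that `ξ` are
arguments of the components of `w`. -/
theorem isTriangle_iff {s : Fin 3 → ℂ} (hs : s 0 + s 1 + s 2 = 0) {p : ℙ ℝ (Fin 6 → ℝ)}
    {ξ : AddCircle Real.pi × AddCircle Real.pi × AddCircle Real.pi} :
    IsTriangle s p ξ.1 ξ.2.1 ξ.2.2 ↔ ∃ (w : Fin 3 → ℂ) (hw : w ≠ 0) (t : ℝ),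
      w 0 + w 1 + w 2 = 0 ∧ s = (t : ℂ) • w ∧
      p = Projectivization.mk ℝ (realCoords w) (realCoords_ne_zero hw) ∧
      ∀ l, w l ≠ 0 → coord3 ξ l = argModPi (w l) := by
  constructor
  · rintro ⟨h1, v, hv, rfl, h2, h3, h4, h5⟩
    have key : ∀ l, complexCoords v l ≠ 0 → coord3 ξ l = argModPi (complexCoords v l) := by
      intro l
      fin_cases l
      exacts [h3, h4, h5]
    -- If all sides vanish, `w` is the given representative of `p` and `t = 0`; otherwise `w = s`
    -- and `t = 1`.
    by_cases h0 : s = 0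
    · refine ⟨complexCoords v, complexCoords_ne_zero hv, 0, ?_, by simpa using h0, ?_, key⟩
      · obtain ⟨ha, hb⟩ := h2 h0
        exact Complex.ext (by simpa [complexCoords] using ha) (by simpa [complexCoords] using hb)
      · simp only [realCoords_complexCoords]
    · obtain ⟨h, he⟩ := h1 h0
      refine ⟨s, h0, 1, hs, by simp, he, fun l hl => ?_⟩
      -- The representative `v` is a real multiple of `s`, and real factors do not change arguments
      -- modulo `π`.
      obtain ⟨a, ha⟩ := (Projectivization.mk_eq_mk_iff' ℝ _ _ hv h).1 he
      have ha0 : a ≠ 0 := by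
        rintro rfl
        exact hv (by rw [← ha, zero_smul])
      have e : complexCoords v = (a : ℂ) • s := by
        rw [← ha, complexCoords_smul, complexCoords_realCoords]
      have hl' : complexCoords v l = a * s l := by rw [e]; rfl
      rw [key l (by rw [hl']; exact mul_ne_zero (by exact_mod_cast ha0) hl), hl',
        argModPi_real_mul a ha0]
  · rintro ⟨w, hw, t, hsum, rfl, rfl, h⟩
    refine ⟨fun h0 => ?_, realCoords w, realCoords_ne_zero hw, rfl, fun _ => ⟨?_, ?_⟩, ?_⟩
    · refine ⟨realCoords_ne_zero h0, (Projectivization.mk_eq_mk_iff' ℝ _ _ _ _).2 ⟨t⁻¹, ?_⟩⟩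
      have ht : t ≠ 0 := by
        rintro rfl
        exact h0 (by simp)
      rw [realCoords_smul, smul_smul, inv_mul_cancel₀ ht, one_smul]
    · exact congrArg Complex.re hsum
    · exact congrArg Complex.im hsum
    · rw [complexCoords_realCoords]
      exact ⟨h 0, h 1, h 2⟩

/-! ## The space of triangles -/

/-- The points of the ambient space of triangles. -/
abbrev TrianglePoint : Type := ℂ × SideVectors × ℙ ℝ (Fin 6 → ℝ) ×
  AddCircle Real.pi × AddCircle Real.pi × AddCircle Real.pi

/-! ### Regularity of the components of a point of the ambient space. -/

section projections

variable (ω : TrianglePoint)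

theorem regAt_base : RegAt triangleAmbient (affine ℂ) (fun ω : TrianglePoint => ω.1) ω :=
  regAt_fst _

theorem regAt_sides : RegAt triangleAmbient sideVectors (fun ω : TrianglePoint => ω.2.1) ω :=
  RegAt.comp (regAt_fst (X := sideVectors) (Y := (projective ℝ (Fin 6 → ℝ)).prod circle3) ω.2)
    (regAt_snd (X := affine ℂ) (Y := sideVectors.prod ((projective ℝ (Fin 6 → ℝ)).prod circle3)) ω)

theorem regAt_shape_args :
    RegAt triangleAmbient ((projective ℝ (Fin 6 → ℝ)).prod circle3)
      (fun ω : TrianglePoint => ω.2.2) ω :=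
  RegAt.comp (regAt_snd (X := sideVectors) (Y := (projective ℝ (Fin 6 → ℝ)).prod circle3) ω.2)
    (regAt_snd (X := affine ℂ) (Y := sideVectors.prod ((projective ℝ (Fin 6 → ℝ)).prod circle3)) ω)

theorem regAt_shape :
    RegAt triangleAmbient (projective ℝ (Fin 6 → ℝ)) (fun ω : TrianglePoint => ω.2.2.1) ω :=
  RegAt.comp (regAt_fst (X := projective ℝ (Fin 6 → ℝ)) (Y := circle3) ω.2.2) (regAt_shape_args ω)

theorem regAt_args : RegAt triangleAmbient circle3 (fun ω : TrianglePoint => ω.2.2.2) ω :=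
  RegAt.comp (regAt_snd (X := projective ℝ (Fin 6 → ℝ)) (Y := circle3) ω.2.2) (regAt_shape_args ω)

theorem regAt_arg (l : Fin 3) :
    RegAt triangleAmbient circle (fun ω : TrianglePoint => coord3 ω.2.2.2 l) ω :=
  RegAt.comp (X := triangleAmbient) (regAt_coord3 l ω.2.2.2) (regAt_args ω)

theorem regC_side (l : Fin 3) :
    triangleAmbient.RegC (fun ω : TrianglePoint => ω.2.1.1 l) ω :=
  (RegAt.comp (X := triangleAmbient) (Y := sideVectors) (Z := affine (Fin 3 → ℂ))
    (g := Subtype.val) (regAt_val _ _) (regAt_sides ω)).regC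
    (g := fun w : Fin 3 → ℂ => w l) (affine_regC (V := Fin 3 → ℂ) (LinearMap.proj l) ω.2.1.1)

end projections

theorem triangleAmbient_separatesPoints : triangleAmbient.SeparatesPoints :=
  (SeparatesPoints.affine ℂ).prod (((SeparatesPoints.affine (Fin 3 → ℂ)).sub _).prod
    (SeparatesPoints.projective.prod circle3_separatesPoints))

/-- The points of the projective space of shapes whose component `l` is not orthogonal to `e`. -/
def shapeDomain (e : ℂ) (l : Fin 3) : Set (ℙ ℝ (Fin 6 → ℝ)) :=
  {p | (complexCoords p.rep l / e).re ≠ 0}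

theorem shape_regC_div (e : ℂ) (l : Fin 3) (v : Fin 6 → ℝ) :
    (affine (Fin 6 → ℝ)).RegC (fun v : Fin 6 → ℝ => complexCoords v l / e) v :=
  (regAt_linear (complexCoord l) v).regC (affine_regC_div e _)

theorem smul_div_re (e : ℂ) (l : Fin 3) (t : ℝ) (v : Fin 6 → ℝ) :
    (complexCoords (t • v) l / e).re = t * (complexCoords v l / e).re := by
  rw [complexCoords_smul, Pi.smul_apply, smul_eq_mul, ofReal_mul_div_re]

theorem smul_div_im (e : ℂ) (l : Fin 3) (t : ℝ) (v : Fin 6 → ℝ) :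
    (complexCoords (t • v) l / e).im = t * (complexCoords v l / e).im := by
  rw [complexCoords_smul, Pi.smul_apply, smul_eq_mul, ofReal_mul_div_im]

theorem isOpen_shapeDomain (e : ℂ) (l : Fin 3) :
    IsOpen[(projective ℝ (Fin 6 → ℝ)).top] (shapeDomain e l) :=
  projective_isOpen (fun v => (shape_regC_div e l v).1) fun t v ht hv => by
    rw [smul_div_re]
    exact mul_ne_zero ht hv

theorem isOpen_shape_ne_zero (l : Fin 3) :
    IsOpen[(projective ℝ (Fin 6 → ℝ)).top]
      {p : ℙ ℝ (Fin 6 → ℝ) | Complex.normSq (complexCoords p.rep l) ≠ 0} :=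
  projective_isOpen (K := ℝ) (D := fun v : Fin 6 → ℝ => Complex.normSq (complexCoords v l))
    (fun v => (affine_regC (complexCoord l) v).normSq) fun t v ht hv => by
    rw [complexCoords_smul, Pi.smul_apply, smul_eq_mul, map_mul, Complex.normSq_ofReal]
    exact mul_ne_zero (mul_ne_zero ht ht) hv

/-- The ratio of two real coordinates of a shape is regular. -/
theorem shape_reg_ratio {e : ℂ} {l : Fin 3} {p : ℙ ℝ (Fin 6 → ℝ)} (hp : p ∈ shapeDomain e l)
    {f : (Fin 6 → ℝ) → ℝ} (hf : ∀ v, (affine (Fin 6 → ℝ)).Reg f v)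
    (hf0 : ∀ (t : ℝ) v, f (t • v) = t * f v) :
    (projective ℝ (Fin 6 → ℝ)).Reg
      (fun p : ℙ ℝ (Fin 6 → ℝ) => f p.rep / (complexCoords p.rep l / e).re) p :=
  projective_reg (K := ℝ) (D := fun v : Fin 6 → ℝ => (complexCoords v l / e).re)
    (f := fun v => f v / (complexCoords v l / e).re)
    (fun v => (shape_regC_div e l v).1)
    (fun t v ht hv => by
      rw [smul_div_re]
      exact mul_ne_zero ht hv)
    (fun v hv => reg_div (hf v) (shape_regC_div e l v).1 hv)
    (fun t v ht hv => by rw [smul_div_re, hf0, mul_div_mul_left _ _ ht]) hp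

/-! ### Charts of the space of triangles. -/

section chart

variable (i : Fin 3) (e e' : ℂ)

/-- The directions of the sides of the triangle with coordinates `x`. -/
noncomputable def triangleDirs (x : Fin 6 → ℝ) : Fin 3 → ℂ :=
  cyc i (slopeVec e (x 4)) (slopeVec e' (x 5)) (-(x 3 * slopeVec e (x 4)) - slopeVec e' (x 5))

/-- The shape of the triangle with coordinates `x`. -/
noncomputable def triangleShape (x : Fin 6 → ℝ) : Fin 3 → ℂ :=
  cyc i (x 3 * slopeVec e (x 4)) (slopeVec e' (x 5)) (-(x 3 * slopeVec e (x 4)) - slopeVec e' (x 5))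

theorem triangleShape_sum (x : Fin 6 → ℝ) :
    triangleShape i e e' x 0 + triangleShape i e e' x 1 + triangleShape i e e' x 2 = 0 := by
  rw [triangleShape, cyc_sum]
  ring

variable {e'} in
theorem triangleShape_ne_zero (he' : e' ≠ 0) (x : Fin 6 → ℝ) : triangleShape i e e' x ≠ 0 :=
  ne_zero_of_apply (l := i + 1) (by simpa [triangleShape] using slopeVec_ne_zero he' _)

variable {e'} in
/-- The triangle with coordinates `x` in the chart where the sides `i + 1` and `i + 2` are not zero,
side `i + 1` is not orthogonal to `e'` and the argument of side `i` is not orthogonal to `e`. -/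
noncomputable def triangleChart (he' : e' ≠ 0) (x : Fin 6 → ℝ) : TrianglePoint :=
  (⟨x 0, x 1⟩, ⟨(x 2 : ℂ) • triangleShape i e e' x, by
      simp only [Pi.smul_apply, ← smul_add, triangleShape_sum, smul_zero]⟩,
    Projectivization.mk ℝ (realCoords (triangleShape i e e' x))
      (realCoords_ne_zero (triangleShape_ne_zero i e he' x)),
    argModPi (triangleDirs i e e' x 0), argModPi (triangleDirs i e e' x 1),
    argModPi (triangleDirs i e e' x 2))

/-- The domain of a chart of the space of triangles. -/
def triangleChartDomain : Set TrianglePoint :=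
  {ω | ω.2.2.1 ∈ shapeDomain e' (i + 1) ∧ Complex.normSq (complexCoords ω.2.2.1.rep (i + 2)) ≠ 0 ∧
    coord3 ω.2.2.2 i ∈ slopeDomain e}

/-- The coordinates of a triangle in a chart. -/
noncomputable def triangleCoords (ω : TrianglePoint) : Fin 6 → ℝ :=
  ![ω.1.re, ω.1.im, (ω.2.1.1 (i + 1) / e').re,
    (complexCoords ω.2.2.1.rep i / e).re / (complexCoords ω.2.2.1.rep (i + 1) / e').re,
    slope e (coord3 ω.2.2.2 i),
    (complexCoords ω.2.2.1.rep (i + 1) / e').im / (complexCoords ω.2.2.1.rep (i + 1) / e').re]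

/-- The polynomial that does not vanish where side `i + 2` is not zero. -/
noncomputable def triangleChartPoly : MvPolynomial (Fin 6) ℝ :=
  let C := fun r : ℝ => (MvPolynomial.C r : MvPolynomial (Fin 6) ℝ)
  let X := fun k : Fin 6 => (MvPolynomial.X k : MvPolynomial (Fin 6) ℝ)
  (X 3 * (C e.re - X 4 * C e.im) + (C e'.re - X 5 * C e'.im)) ^ 2 +
    (X 3 * (C e.im + X 4 * C e.re) + (C e'.im + X 5 * C e'.re)) ^ 2

theorem eval_triangleChartPoly (x : Fin 6 → ℝ) :
    MvPolynomial.eval x (triangleChartPoly e e') =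
      Complex.normSq (-(x 3 * slopeVec e (x 4)) - slopeVec e' (x 5)) := by
  simp [triangleChartPoly, slopeVec, Complex.normSq_apply]
  ring

theorem isOpen_triangleChartDomain :
    IsOpen[triangleAmbient.top] (triangleChartDomain i e e') := by
  have h : Continuous[triangleAmbient.top, (projective ℝ (Fin 6 → ℝ)).top]
    (fun ω : TrianglePoint => ω.2.2.1) := RegAt.continuous (X := triangleAmbient) (Y := projective ℝ (Fin 6 → ℝ)) regAt_shape
  have h' : Continuous[triangleAmbient.top, circle.top]
    (fun ω : TrianglePoint => coord3 ω.2.2.2 i) :=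
    RegAt.continuous (X := triangleAmbient) (Y := circle) fun ω => regAt_arg ω i
  exact IsOpen.inter (X := triangleAmbient) (h.isOpen_preimage _ (isOpen_shapeDomain e' (i + 1)))
    (IsOpen.inter (X := triangleAmbient) (h.isOpen_preimage _ (isOpen_shape_ne_zero (i + 2)))
      (h'.isOpen_preimage _ (isOpen_slopeDomain e)))

theorem regC_slopeVec_coord (e : ℂ) (k : Fin 6) (x : Fin 6 → ℝ) :
    (affine (Fin 6 → ℝ)).RegC (fun x : Fin 6 → ℝ => slopeVec e (x k)) x :=
  RegC.slopeVec e (X := affine (Fin 6 → ℝ)) (f := fun x : Fin 6 → ℝ => x k)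
    (affine_reg (V := Fin 6 → ℝ) (LinearMap.proj k) x)

theorem regC_triangleShape (x : Fin 6 → ℝ) (l : Fin 3) :
    (affine (Fin 6 → ℝ)).RegC (fun x : Fin 6 → ℝ => triangleShape i e e' x l) x := by
  have h := (RegC.ofReal (affine_reg (LinearMap.proj 3) x)).mul (regC_slopeVec_coord e 4 x)
  exact h.cyc (regC_slopeVec_coord e' 5 x) (h.neg.sub (regC_slopeVec_coord e' 5 x)) i l

theorem regC_triangleDirs (x : Fin 6 → ℝ) (l : Fin 3) :
    (affine (Fin 6 → ℝ)).RegC (fun x : Fin 6 → ℝ => triangleDirs i e e' x l) x := by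
  have h := (RegC.ofReal (affine_reg (LinearMap.proj 3) x)).mul (regC_slopeVec_coord e 4 x)
  exact (regC_slopeVec_coord e 4 x).cyc (regC_slopeVec_coord e' 5 x)
    (h.neg.sub (regC_slopeVec_coord e' 5 x)) i l

variable {e e'}

theorem triangleDirs_ne_zero (he : e ≠ 0) (he' : e' ≠ 0) {x : Fin 6 → ℝ}
    (hx : MvPolynomial.eval x (triangleChartPoly e e') ≠ 0) (l : Fin 3) :
    triangleDirs i e e' x l ≠ 0 := by
  rw [eval_triangleChartPoly] at hx
  rcases fin3_cases i l with rfl | rfl | rfl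
  · simpa [triangleDirs] using slopeVec_ne_zero he _
  · simpa [triangleDirs] using slopeVec_ne_zero he' _
  · simpa [triangleDirs] using (map_ne_zero _).1 hx

/-- The polynomial condition is needed only for the argument of side `i + 2`; the other two
direction vectors and the shape never vanish. -/
theorem regAt_triangleChart (he : e ≠ 0) (he' : e' ≠ 0) {x : Fin 6 → ℝ}
    (hx : MvPolynomial.eval x (triangleChartPoly e e') ≠ 0) :
    RegAt (affine (Fin 6 → ℝ)) triangleAmbient (triangleChart i e he') x := by
  refine regAt_prod (regAt_affine_complex ⟨affine_reg (LinearMap.proj 0) x,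
    affine_reg (LinearMap.proj 1) x⟩) (regAt_prod (Y := (projective ℝ (Fin 6 → ℝ)).prod circle3)
    (regAt_sub (regAt_affine_complex_pi fun l =>
      (RegC.ofReal (affine_reg (LinearMap.proj 2) x)).mul (regC_triangleShape i e e' x l)))
    (regAt_prod (regAt_mk_realCoords (triangleShape_ne_zero i e he') fun l => regC_triangleShape i e e' x l)
      (regAt_circle3 (X := affine (Fin 6 → ℝ)) (f := fun l (x : Fin 6 → ℝ) => argModPi (triangleDirs i e e' x l)) fun l =>
        regAt_argModPi (regC_triangleDirs i e e' x l) (triangleDirs_ne_zero i he he' hx l))))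

theorem coord3_triangleChart (he' : e' ≠ 0) (x : Fin 6 → ℝ) (l : Fin 3) :
    coord3 (triangleChart i e he' x).2.2.2 l = argModPi (triangleDirs i e e' x l) := by
  fin_cases l <;> rfl

/-- The two triples differ only at `i`, by the real factor `x 3`. Where `x 3 = 0`, side `i` vanishes
but `triangleDirs` keeps a direction for it. -/
theorem argModPi_triangleDirs {x : Fin 6 → ℝ} {l : Fin 3}
    (h : triangleShape i e e' x l ≠ 0) :
    argModPi (triangleDirs i e e' x l) = argModPi (triangleShape i e e' x l) := by
  rcases fin3_cases i l with rfl | rfl | rfl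
  · simp only [triangleShape, triangleDirs, cyc_zero] at h ⊢
    rw [argModPi_real_mul]
    rintro h0
    exact h (by rw [h0]; simp)
  · simp [triangleShape, triangleDirs]
  · simp [triangleShape, triangleDirs]

theorem triangleChart_mem (he' : e' ≠ 0) (x : Fin 6 → ℝ) :
    triangleChart i e he' x ∈ triangles := by
  refine (isTriangle_iff (ξ := (triangleChart i e he' x).2.2.2) (triangleChart i e he' x).2.1.2).2 ⟨triangleShape i e e' x,
    triangleShape_ne_zero i e he' x, x 2, triangleShape_sum i e e' x, rfl, rfl, fun l hl => ?_⟩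
  rw [coord3_triangleChart, argModPi_triangleDirs i hl]

theorem exists_complexCoords_rep {w : Fin 3 → ℂ} (hw : w ≠ 0) : ∃ t : ℝ, t ≠ 0 ∧
    complexCoords (Projectivization.mk ℝ (realCoords w) (realCoords_ne_zero hw)).rep =
      (t : ℂ) • w := by
  obtain ⟨a, ha⟩ := Projectivization.exists_smul_eq_mk_rep ℝ (realCoords w) (realCoords_ne_zero hw)
  refine ⟨a, a.ne_zero, ?_⟩
  rw [← ha, Units.smul_def, complexCoords_smul, complexCoords_realCoords]

theorem triangleChart_mem_domain (he : e ≠ 0) (he' : e' ≠ 0) {x : Fin 6 → ℝ}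
    (hx : MvPolynomial.eval x (triangleChartPoly e e') ≠ 0) :
    triangleChart i e he' x ∈ triangleChartDomain i e e' := by
  obtain ⟨t, ht, h⟩ := exists_complexCoords_rep (triangleShape_ne_zero i e he' x)
  refine ⟨?_, ?_, ?_⟩
  · change (complexCoords (Projectivization.mk ℝ _ _).rep (i + 1) / e').re ≠ 0
    rw [h, Pi.smul_apply, smul_eq_mul, ofReal_mul_div_re, triangleShape, cyc_one, slopeVec_div he']
    simpa using ht
  · change Complex.normSq (complexCoords (Projectivization.mk ℝ _ _).rep (i + 2)) ≠ 0
    rw [h, Pi.smul_apply, smul_eq_mul, map_mul, triangleShape, cyc_two, ← eval_triangleChartPoly]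
    exact mul_ne_zero (by simpa using ht) hx
  · rw [coord3_triangleChart, triangleDirs, cyc_zero]
    exact argModPi_slopeVec_mem he _

theorem triangleAmbient_reg_coords {ω : TrianglePoint} (hω : ω ∈ triangleChartDomain i e e')
    (j : Fin 6) : triangleAmbient.Reg (fun ω : TrianglePoint => triangleCoords i e e' ω j) ω := by
  fin_cases j
  · exact (regAt_base ω).reg (affine_reg Complex.reLm _)
  · exact (regAt_base ω).reg (affine_reg Complex.imLm _)
  · exact (RegC.mul (regC_side ω (i + 1)) (RegC.const e'⁻¹ _)).1
  · exact (regAt_shape ω).reg (shape_reg_ratio hω.1 (f := fun v => (complexCoords v i / e).re)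
      (fun v => (shape_regC_div e i v).1) (smul_div_re e i))
  · exact (regAt_arg ω i).reg (circle_reg_slope hω.2.2)
  · exact (regAt_shape ω).reg (shape_reg_ratio hω.1
      (f := fun v => (complexCoords v (i + 1) / e').im)
      (fun v => (shape_regC_div e' (i + 1) v).2) (smul_div_im e' (i + 1)))

/-- The unknown real factor `t` of the representative cancels in the ratios, and `slopeVec e' (x 5)
/ e'` has real part `1`, so side `i + 1` yields the scale `x 2` and the slope `x 5`. -/
theorem triangleCoords_chart (he : e ≠ 0) (he' : e' ≠ 0) (x : Fin 6 → ℝ) :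
    triangleCoords i e e' (triangleChart i e he' x) = x := by
  obtain ⟨t, ht, h⟩ := exists_complexCoords_rep (triangleShape_ne_zero i e he' x)
  have h' : complexCoords (triangleChart i e he' x).2.2.1.rep = _ := h
  have h0 : (complexCoords (triangleChart i e he' x).2.2.1.rep i / e).re = t * x 3 := by
    rw [h', Pi.smul_apply, smul_eq_mul, ofReal_mul_div_re, triangleShape, cyc_zero,
      ofReal_mul_div_re, slopeVec_div he]
    simp
  have h1 : complexCoords (triangleChart i e he' x).2.2.1.rep (i + 1) / e' =
      t * (1 + x 5 * Complex.I) := by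
    rw [h', Pi.smul_apply, smul_eq_mul, triangleShape, cyc_one, mul_div_assoc, slopeVec_div he']
  have h2 : (triangleChart i e he' x).2.1.1 (i + 1) / e' = x 2 * (1 + x 5 * Complex.I) := by
    change ((x 2 : ℂ) • triangleShape i e e' x) (i + 1) / e' = _
    rw [Pi.smul_apply, smul_eq_mul, triangleShape, cyc_one, mul_div_assoc, slopeVec_div he']
  funext j
  fin_cases j
  · rfl
  · rfl
  · change ((triangleChart i e he' x).2.1.1 (i + 1) / e').re = _
    rw [h2]
    simp
  · change (complexCoords (triangleChart i e he' x).2.2.1.rep i / e).re /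
      (complexCoords (triangleChart i e he' x).2.2.1.rep (i + 1) / e').re = _
    rw [h0, h1]
    simp [ht]
  · change slope e (coord3 (triangleChart i e he' x).2.2.2 i) = _
    rw [coord3_triangleChart, triangleDirs, cyc_zero, slope_argModPi_slopeVec he]
    rfl
  · change (complexCoords (triangleChart i e he' x).2.2.1.rep (i + 1) / e').im /
      (complexCoords (triangleChart i e he' x).2.2.1.rep (i + 1) / e').re = _
    rw [h1]
    simp [ht]

/-- With `ρ` the component of `w (i + 1)` along `e'`, the vector `ρ⁻¹ w` is the normalized shape,
and the scale `t` becomes `t ρ`. Its entry at `i + 2` is right automatically, because the sum is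
zero. -/
theorem exists_of_mem_triangleChartDomain (he : e ≠ 0) (he' : e' ≠ 0) {ω : TrianglePoint}
    (hω : ω ∈ triangles) (hU : ω ∈ triangleChartDomain i e e') :
    ∃ x, MvPolynomial.eval x (triangleChartPoly e e') ≠ 0 ∧ triangleChart i e he' x = ω := by
  obtain ⟨B, s, p, ξ⟩ := ω
  obtain ⟨w, hw, t, hsum, hst, rfl, harg⟩ := (isTriangle_iff s.2).1 hω
  obtain ⟨a, ha, hrep⟩ := exists_complexCoords_rep hw
  obtain ⟨h1, h2, h3⟩ := hU
  change (complexCoords (Projectivization.mk ℝ _ _).rep (i + 1) / e').re ≠ 0 at h1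
  change Complex.normSq (complexCoords (Projectivization.mk ℝ _ _).rep (i + 2)) ≠ 0 at h2
  rw [hrep, Pi.smul_apply, smul_eq_mul] at h1 h2
  rw [ofReal_mul_div_re] at h1
  rw [map_mul] at h2
  set ρ := (w (i + 1) / e').re with hρ
  have hρ0 : ρ ≠ 0 := right_ne_zero_of_mul h1
  have hρC : (ρ : ℂ) ≠ 0 := by exact_mod_cast hρ0
  have hw2 : w (i + 2) ≠ 0 := (map_ne_zero _).1 (right_ne_zero_of_mul h2)
  have hw1 : w (i + 1) = ρ * slopeVec e' ((w (i + 1) / e').im / ρ) := eq_re_mul_slopeVec he' hρ0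
  -- This includes the case `w i = 0`, where `slope e (coord3 ξ i)` records the free argument.
  have hw0 : w i = (w i / e).re * slopeVec e (slope e (coord3 ξ i)) :=
    eq_re_mul_slopeVec_slope he h3 (harg i)
  have hs2 : w (i + 2) = -w i - w (i + 1) := by
    have := fin3_sum w i
    rw [hsum] at this
    linear_combination this
  let x : Fin 6 → ℝ := ![B.re, B.im, t * ρ, (w i / e).re / ρ, slope e (coord3 ξ i),
    (w (i + 1) / e').im / ρ]
  have hsh0 : (x 3 : ℂ) * slopeVec e (x 4) = (ρ : ℂ)⁻¹ * w i := by
    change (((w i / e).re / ρ : ℝ) : ℂ) * slopeVec e (slope e (coord3 ξ i)) = _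
    conv_rhs => rw [hw0]
    push_cast
    field_simp
  have hsh1 : slopeVec e' (x 5) = (ρ : ℂ)⁻¹ * w (i + 1) := by
    change slopeVec e' ((w (i + 1) / e').im / ρ) = _
    rw [eq_inv_mul_iff_mul_eq₀ hρC]
    exact hw1.symm
  have hsh2 : -((x 3 : ℂ) * slopeVec e (x 4)) - slopeVec e' (x 5) = (ρ : ℂ)⁻¹ * w (i + 2) := by
    rw [hsh0, hsh1, hs2]
    ring
  have hsh : triangleShape i e e' x = ((ρ⁻¹ : ℝ) : ℂ) • w := by
    push_cast
    exact (eq_cyc i _ _ _ hsh0.symm hsh1.symm hsh2.symm).symm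
  refine ⟨x, ?_, ?_⟩
  · rw [eval_triangleChartPoly, hsh2]
    exact (map_ne_zero _).2 (mul_ne_zero (inv_ne_zero hρC) hw2)
  -- At `i` the argument is recovered from its slope; at `i + 1` and `i + 2` it is determined by the
  -- nonzero sides.
  have hdir : ∀ l, argModPi (triangleDirs i e e' x l) = coord3 ξ l := by
    intro l
    rcases fin3_cases i l with rfl | rfl | rfl
    · rw [triangleDirs, cyc_zero]
      exact argModPi_slopeVec_slope he h3
    · rw [triangleDirs, cyc_one, hsh1, harg _ (by rw [hw1]; exact mul_ne_zero hρC (slopeVec_ne_zero he' _)),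
        ← Complex.ofReal_inv, argModPi_real_mul _ (inv_ne_zero hρ0)]
    · rw [triangleDirs, cyc_two, hsh2, harg _ hw2, ← Complex.ofReal_inv,
        argModPi_real_mul _ (inv_ne_zero hρ0)]
  refine Prod.ext rfl (Prod.ext (Subtype.ext ?_) (Prod.ext ?_
    (Prod.ext (hdir 0) (Prod.ext (hdir 1) (hdir 2)))))
  · change ((t * ρ : ℝ) : ℂ) • triangleShape i e e' x = s.1
    rw [hsh, hst, smul_smul]
    push_cast
    rw [mul_assoc, mul_inv_cancel₀ hρC, mul_one]
  · refine (Projectivization.mk_eq_mk_iff' ℝ _ _ _ _).2 ⟨ρ⁻¹, ?_⟩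
    rw [hsh, realCoords_smul]

end chart

theorem exists_mem_triangleChartDomain {ω : TrianglePoint} (hω : ω ∈ triangles) :
    ∃ k : Fin 3 × Bool × Bool, ω ∈ triangleChartDomain k.1 (axis k.2.1) (axis k.2.2) := by
  obtain ⟨B, s, p, ξ⟩ := ω
  obtain ⟨w, hw, t, hsum, hst, rfl, harg⟩ := (isTriangle_iff s.2).1 hω
  obtain ⟨a, ha, hrep⟩ := exists_complexCoords_rep hw
  obtain ⟨i, h1, h2⟩ := exists_two_ne_zero hw hsum
  obtain ⟨b', hb'⟩ := exists_div_axis_re_ne_zero h1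
  obtain ⟨b, hb⟩ := exists_mem_slopeDomain_axis (coord3 ξ i)
  refine ⟨(i, b, b'), ?_, ?_, hb⟩
  · change (complexCoords (Projectivization.mk ℝ _ _).rep (i + 1) / axis b').re ≠ 0
    rw [hrep, Pi.smul_apply, smul_eq_mul, ofReal_mul_div_re]
    exact mul_ne_zero ha hb'
  · change Complex.normSq (complexCoords (Projectivization.mk ℝ _ _).rep (i + 2)) ≠ 0
    rw [hrep, Pi.smul_apply, smul_eq_mul]
    exact (map_ne_zero _).2 (mul_ne_zero (by exact_mod_cast ha) h2)

theorem triangleSpace_isSmoothVariety : triangleSpace.IsSmoothVariety := by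
  refine isSmoothVariety_of_charts triangleAmbient_separatesPoints
    (fun k : Fin 3 × Bool × Bool => triangleChartDomain k.1 (axis k.2.1) (axis k.2.2))
    (fun k => isOpen_triangleChartDomain _ _ _) (fun ω hω => exists_mem_triangleChartDomain hω)
    fun ⟨i, b, b'⟩ => ?_
  have he := axis_ne_zero b
  have he' := axis_ne_zero b'
  refine isSmoothAffine_of_chart (triangleChartPoly (axis b) (axis b')) (triangleChart i (axis b) he')
    (triangleCoords i (axis b) (axis b')) (fun x hx => regAt_triangleChart i he he' hx)
    (fun x _ => triangleChart_mem i he' x) (fun x hx => triangleChart_mem_domain i he he' hx)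
    (fun ω hω j => triangleAmbient_reg_coords i hω j) ?_ (fun x _ => triangleCoords_chart i he he' x)
    ?_
  -- Every triangle in the chart domain is the image of some `x`, so both remaining conditions
  -- follow from `triangleCoords_chart`.
  · intro ω hω hU
    obtain ⟨x, hx, rfl⟩ := exists_of_mem_triangleChartDomain i he he' hω hU
    rwa [triangleCoords_chart i he he']
  · intro ω hω hU
    obtain ⟨x, hx, rfl⟩ := exists_of_mem_triangleChartDomain i he he' hω hU
    rw [triangleCoords_chart i he he']

/-! ## The space of triangle classes -/

/-- The points of the ambient space of triangle classes. -/
abbrev ClassPoint : Type := projSideSet × torusSet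

theorem regAt_classShape (ω : ClassPoint) :
    RegAt classAmbient (projective ℂ (Fin 3 → ℂ)) (fun ω : ClassPoint => ω.1.1) ω :=
  RegAt.comp (X := classAmbient) (Y := projSideVectors) (Z := projective ℂ (Fin 3 → ℂ))
    (f := fun ω : ClassPoint => ω.1) (g := Subtype.val) (regAt_val _ _)
    (regAt_fst (X := projSideVectors) (Y := torus) ω)

theorem regAt_angle (ω : ClassPoint) (l : Fin 3) :
    RegAt classAmbient circle (fun ω : ClassPoint => coord3 ω.2.1 l) ω :=
  RegAt.comp (X := classAmbient) (Y := circle3) (Z := circle) (f := fun ω : ClassPoint => ω.2.1)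
    (regAt_coord3 l ω.2.1)
    (RegAt.comp (X := classAmbient) (Y := torus) (Z := circle3) (f := fun ω : ClassPoint => ω.2)
      (g := Subtype.val) (regAt_val _ _) (regAt_snd (X := projSideVectors) (Y := torus) ω))

theorem classAmbient_separatesPoints : classAmbient.SeparatesPoints :=
  (SeparatesPoints.projective.sub _).prod (circle3_separatesPoints.sub _)

theorem coord3_ext {ξ η : AddCircle Real.pi × AddCircle Real.pi × AddCircle Real.pi}
    (h : ∀ l, coord3 ξ l = coord3 η l) : ξ = η :=
  Prod.ext (h 0) (Prod.ext (h 1) (h 2))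

theorem coord3_mk (f : Fin 3 → AddCircle Real.pi) (l : Fin 3) : coord3 (f 0, f 1, f 2) l = f l := by
  fin_cases l <;> rfl

/-- Real proportionality implies complex proportionality, so the complex class of the sides depends
only on the real shape. -/
theorem projectivization_mk_complexCoords {v v' : Fin 6 → ℝ} {hv : v ≠ 0} {hv' : v' ≠ 0}
    (h : Projectivization.mk ℝ v hv = Projectivization.mk ℝ v' hv') :
    Projectivization.mk ℂ (complexCoords v) (complexCoords_ne_zero hv) =
      Projectivization.mk ℂ (complexCoords v') (complexCoords_ne_zero hv') := by
  obtain ⟨a, ha⟩ := (Projectivization.mk_eq_mk_iff' ℝ _ _ _ _).1 h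
  refine (Projectivization.mk_eq_mk_iff' ℂ _ _ _ _).2 ⟨a, ?_⟩
  rw [← ha, complexCoords_smul]

/-- Triangle classes are the pairs `([w]; θ)` such that `θ` are the differences of arguments of the
components of `w`. -/
theorem mem_triangleClasses_iff {ω : ClassPoint} :
    ω ∈ triangleClasses ↔ ∃ (w : Fin 3 → ℂ) (hw : w ≠ 0)
      (η : AddCircle Real.pi × AddCircle Real.pi × AddCircle Real.pi),
      w 0 + w 1 + w 2 = 0 ∧ ω.1.1 = Projectivization.mk ℂ w hw ∧
      (∀ l, w l ≠ 0 → coord3 η l = argModPi (w l)) ∧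
      ∀ l, coord3 ω.2.1 l = coord3 η (l + 1) - coord3 η (l + 2) := by
  constructor
  · rintro ⟨⟨B, s, p, ξ⟩, hT, ⟨v, hv, hv', hp, hc⟩, h0, h1, h2⟩
    obtain ⟨w, hw, t, hsum, -, hpw, harg⟩ := (isTriangle_iff s.2).1 hT
    refine ⟨w, hw, ξ, hsum, ?_, harg, fun l => ?_⟩
    · rw [hc, projectivization_mk_complexCoords (hp.symm.trans hpw)]
      simp only [complexCoords_realCoords]
    · fin_cases l
      exacts [h0, h1, h2]
  -- The class is realized by the triangle with basepoint `0`, sides `w` and arguments `η`.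
  · rintro ⟨w, hw, η, hsum, hc, harg, hθ⟩
    refine ⟨(0, ⟨w, hsum⟩, Projectivization.mk ℝ (realCoords w) (realCoords_ne_zero hw), η),
      (isTriangle_iff hsum).2 ⟨w, hw, 1, hsum, by simp, rfl, harg⟩,
      ⟨realCoords w, realCoords_ne_zero hw, complexCoords_ne_zero (realCoords_ne_zero hw), rfl, ?_⟩,
      hθ 0, hθ 1, hθ 2⟩
    rw [hc]
    simp only [complexCoords_realCoords]

/-- Regularity of subtraction on the circle is bypassed: near `x` the difference is the argument of
`f` times the conjugate of `g`. -/
theorem regAt_argModPi_sub {X : RSpace} {f g : X → ℂ} {x : X} (hf : X.RegC f x)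
    (hg : X.RegC g x) (hf0 : f x ≠ 0) (hg0 : g x ≠ 0) :
    RegAt X circle (fun y => argModPi (f y) - argModPi (g y)) x := by
  refine (regAt_argModPi (hf.mul hg.conj) (mul_ne_zero hf0 (by simpa using hg0))).congr ?_
  filter_upwards [hf.eventually_ne hf0, hg.eventually_ne hg0] with y h1 h2
  exact argModPi_mul_conj h1 h2

/-- The non-vanishing locus of a component in the complex projective plane. -/
def componentDomain (l : Fin 3) : Set (ℙ ℂ (Fin 3 → ℂ)) :=
  {p | Complex.normSq (p.rep l) ≠ 0}

theorem normSq_smul_ne_zero (l : Fin 3) (a : ℂ) (v : Fin 3 → ℂ) (ha : a ≠ 0)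
    (hv : Complex.normSq (v l) ≠ 0) : Complex.normSq ((a • v) l) ≠ 0 := by
  rw [Pi.smul_apply, smul_eq_mul, map_mul]
  exact mul_ne_zero ((map_ne_zero _).2 ha) hv

theorem affine_regC_apply (l : Fin 3) (v : Fin 3 → ℂ) :
    (affine (Fin 3 → ℂ)).RegC (fun v : Fin 3 → ℂ => v l) v :=
  affine_regC (V := Fin 3 → ℂ) (LinearMap.proj l) v

theorem isOpen_componentDomain (l : Fin 3) :
    IsOpen[(projective ℂ (Fin 3 → ℂ)).top] (componentDomain l) :=
  projective_isOpen (K := ℂ) (D := fun v : Fin 3 → ℂ => Complex.normSq (v l))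
    (fun v => (affine_regC_apply l v).normSq) (normSq_smul_ne_zero l)

theorem mk_mem_componentDomain {w : Fin 3 → ℂ} (hw : w ≠ 0) {l : Fin 3} :
    Projectivization.mk ℂ w hw ∈ componentDomain l ↔ w l ≠ 0 := by
  obtain ⟨a, ha⟩ := Projectivization.exists_smul_eq_mk_rep ℂ w hw
  change Complex.normSq ((Projectivization.mk ℂ w hw).rep l) ≠ 0 ↔ _
  rw [map_ne_zero, ← ha, Units.smul_def, Pi.smul_apply, smul_eq_mul]
  exact mul_ne_zero_iff.trans (and_iff_right a.ne_zero)

/-- The quotient of the components `k` and `l` of a point of the complex projective plane. -/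
noncomputable def componentRatio (k l : Fin 3) (p : ℙ ℂ (Fin 3 → ℂ)) : ℂ := p.rep k / p.rep l

theorem componentRatio_mk (k l : Fin 3) {w : Fin 3 → ℂ} (hw : w ≠ 0) :
    componentRatio k l (Projectivization.mk ℂ w hw) = w k / w l := by
  obtain ⟨a, ha⟩ := Projectivization.exists_smul_eq_mk_rep ℂ w hw
  rw [componentRatio, ← ha, Units.smul_def, Pi.smul_apply, Pi.smul_apply, smul_eq_mul, smul_eq_mul,
    mul_div_mul_left _ _ a.ne_zero]

theorem reg_componentRatio (e : ℂ) {k l : Fin 3} {p : ℙ ℂ (Fin 3 → ℂ)}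
    (hp : p ∈ componentDomain l) :
    (projective ℂ (Fin 3 → ℂ)).Reg
      (fun p : ℙ ℂ (Fin 3 → ℂ) => (componentRatio k l p / e).re) p :=
  projective_reg (K := ℂ) (D := fun v : Fin 3 → ℂ => Complex.normSq (v l))
    (f := fun v => (v k / v l / e).re)
    (fun v => (affine_regC_apply l v).normSq) (normSq_smul_ne_zero l)
    (fun v hv => ((affine_regC_apply k v).div (affine_regC_apply l v)
      ((map_ne_zero _).1 hv)).mul (RegC.const (X := affine (Fin 3 → ℂ)) e⁻¹ v) |>.1)
    (fun a v ha _ => by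
      rw [Pi.smul_apply, Pi.smul_apply, smul_eq_mul, smul_eq_mul, mul_div_mul_left _ _ ha]) hp

/-! ### Charts of the space of triangle classes. -/

section chart

variable (i : Fin 3) (e : ℂ)

/-- The directions of the sides of a triangle in the class with coordinates `x`. -/
noncomputable def classDirs (x : Fin 2 → ℝ) : Fin 3 → ℂ :=
  cyc i (slopeVec e (x 1)) 1 (-(x 0 * slopeVec e (x 1)) - 1)

/-- The sides of a triangle in the class with coordinates `x`. -/
noncomputable def classShape (x : Fin 2 → ℝ) : Fin 3 → ℂ :=
  cyc i (x 0 * slopeVec e (x 1)) 1 (-(x 0 * slopeVec e (x 1)) - 1)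

theorem classShape_sum (x : Fin 2 → ℝ) :
    classShape i e x 0 + classShape i e x 1 + classShape i e x 2 = 0 := by
  rw [classShape, cyc_sum]
  ring

theorem classShape_ne_zero (x : Fin 2 → ℝ) : classShape i e x ≠ 0 :=
  ne_zero_of_apply (l := i + 1) (by simp [classShape])

/-- The angles of the class with coordinates `x`. -/
noncomputable def classAngle (x : Fin 2 → ℝ) (l : Fin 3) : AddCircle Real.pi :=
  argModPi (classDirs i e x (l + 1)) - argModPi (classDirs i e x (l + 2))

theorem classAngle_sum (x : Fin 2 → ℝ) :
    classAngle i e x 0 + classAngle i e x 1 + classAngle i e x 2 = 0 := by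
  simp only [classAngle, Fin.reduceAdd, zero_add]
  abel

/-- The triangle class with coordinates `x` in the chart where the sides `i + 1` and `i + 2` are not
zero and the angle between the sides `i` and `i + 1` is not orthogonal to `e`. -/
noncomputable def classChart (x : Fin 2 → ℝ) : ClassPoint :=
  (⟨Projectivization.mk ℂ (classShape i e x) (classShape_ne_zero i e x),
      classShape i e x, classShape_ne_zero i e x, rfl, classShape_sum i e x⟩,
    ⟨(classAngle i e x 0, classAngle i e x 1, classAngle i e x 2), classAngle_sum i e x⟩)

/-- The domain of a chart of the space of triangle classes. -/
def classChartDomain : Set ClassPoint :=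
  {ω | ω.1.1 ∈ componentDomain (i + 1) ∧ ω.1.1 ∈ componentDomain (i + 2) ∧
    coord3 ω.2.1 (i + 2) ∈ slopeDomain e}

/-- The coordinates of a triangle class in a chart. -/
noncomputable def classCoords (ω : ClassPoint) : Fin 2 → ℝ :=
  ![(componentRatio i (i + 1) ω.1.1 / e).re, slope e (coord3 ω.2.1 (i + 2))]

/-- The polynomial that does not vanish where side `i + 2` is not zero. -/
noncomputable def classChartPoly : MvPolynomial (Fin 2) ℝ :=
  let C := fun r : ℝ => (MvPolynomial.C r : MvPolynomial (Fin 2) ℝ)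
  let X := fun k : Fin 2 => (MvPolynomial.X k : MvPolynomial (Fin 2) ℝ)
  (X 0 * (C e.re - X 1 * C e.im) + 1) ^ 2 + (X 0 * (C e.im + X 1 * C e.re)) ^ 2

theorem eval_classChartPoly (x : Fin 2 → ℝ) :
    MvPolynomial.eval x (classChartPoly e) =
      Complex.normSq (-(x 0 * slopeVec e (x 1)) - 1) := by
  simp [classChartPoly, slopeVec, Complex.normSq_apply]
  ring

theorem isOpen_classChartDomain : IsOpen[classAmbient.top] (classChartDomain i e) := by
  have h : Continuous[classAmbient.top, (projective ℂ (Fin 3 → ℂ)).top]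
    (fun ω : ClassPoint => ω.1.1) :=
    RegAt.continuous (X := classAmbient) (Y := projective ℂ (Fin 3 → ℂ)) regAt_classShape
  have h' : Continuous[classAmbient.top, circle.top]
    (fun ω : ClassPoint => coord3 ω.2.1 (i + 2)) :=
    RegAt.continuous (X := classAmbient) (Y := circle) fun ω => regAt_angle ω (i + 2)
  exact IsOpen.inter (X := classAmbient) (h.isOpen_preimage _ (isOpen_componentDomain (i + 1)))
    (IsOpen.inter (X := classAmbient) (h.isOpen_preimage _ (isOpen_componentDomain (i + 2)))
      (h'.isOpen_preimage _ (isOpen_slopeDomain e)))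

theorem regC_slopeVec_apply (x : Fin 2 → ℝ) :
    (affine (Fin 2 → ℝ)).RegC (fun x : Fin 2 → ℝ => slopeVec e (x 1)) x :=
  RegC.slopeVec e (X := affine (Fin 2 → ℝ)) (f := fun x : Fin 2 → ℝ => x 1)
    (affine_reg (V := Fin 2 → ℝ) (LinearMap.proj 1) x)

theorem regC_mul_slopeVec_apply (x : Fin 2 → ℝ) :
    (affine (Fin 2 → ℝ)).RegC (fun x : Fin 2 → ℝ => x 0 * slopeVec e (x 1)) x :=
  (RegC.ofReal (X := affine (Fin 2 → ℝ)) (f := fun x : Fin 2 → ℝ => x 0)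
    (affine_reg (V := Fin 2 → ℝ) (LinearMap.proj 0) x)).mul (regC_slopeVec_apply e x)

theorem regC_classShape (x : Fin 2 → ℝ) (l : Fin 3) :
    (affine (Fin 2 → ℝ)).RegC (fun x : Fin 2 → ℝ => classShape i e x l) x :=
  (regC_mul_slopeVec_apply e x).cyc (RegC.const (X := affine (Fin 2 → ℝ)) 1 x)
    ((regC_mul_slopeVec_apply e x).neg.sub (RegC.const (X := affine (Fin 2 → ℝ)) 1 x)) i l

theorem regC_classDirs (x : Fin 2 → ℝ) (l : Fin 3) :
    (affine (Fin 2 → ℝ)).RegC (fun x : Fin 2 → ℝ => classDirs i e x l) x :=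
  (regC_slopeVec_apply e x).cyc (RegC.const (X := affine (Fin 2 → ℝ)) 1 x)
    ((regC_mul_slopeVec_apply e x).neg.sub (RegC.const (X := affine (Fin 2 → ℝ)) 1 x)) i l

variable {e}

theorem classDirs_ne_zero (he : e ≠ 0) {x : Fin 2 → ℝ}
    (hx : MvPolynomial.eval x (classChartPoly e) ≠ 0) (l : Fin 3) : classDirs i e x l ≠ 0 := by
  rw [eval_classChartPoly] at hx
  rcases fin3_cases i l with rfl | rfl | rfl
  · simpa [classDirs] using slopeVec_ne_zero he _
  · simp [classDirs]
  · simpa [classDirs] using (map_ne_zero _).1 hx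

theorem regAt_classChart (he : e ≠ 0) {x : Fin 2 → ℝ}
    (hx : MvPolynomial.eval x (classChartPoly e) ≠ 0) :
    RegAt (affine (Fin 2 → ℝ)) classAmbient (classChart i e) x := by
  refine regAt_prod (X := projSideVectors) (Y := torus)
    (regAt_sub (Y := projective ℂ (Fin 3 → ℂ)) ?_) (regAt_sub (Y := circle3) ?_)
  · exact regAt_mk (X := affine (Fin 2 → ℝ)) (f := classShape i e) (classShape_ne_zero i e)
      (regAt_affine_complex_pi fun l => regC_classShape i e x l)
  · exact regAt_circle3 (X := affine (Fin 2 → ℝ)) (f := fun l (x : Fin 2 → ℝ) => classAngle i e x l)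
      fun l => regAt_argModPi_sub (regC_classDirs i e x _) (regC_classDirs i e x _)
        (classDirs_ne_zero i he hx _) (classDirs_ne_zero i he hx _)

theorem argModPi_classDirs {x : Fin 2 → ℝ} {l : Fin 3} (h : classShape i e x l ≠ 0) :
    argModPi (classDirs i e x l) = argModPi (classShape i e x l) := by
  rcases fin3_cases i l with rfl | rfl | rfl
  · simp only [classShape, classDirs, cyc_zero] at h ⊢
    rw [argModPi_real_mul]
    rintro h0
    exact h (by rw [h0]; simp)
  · simp [classShape, classDirs]
  · simp [classShape, classDirs]

theorem classChart_mem (x : Fin 2 → ℝ) : classChart i e x ∈ triangleClasses := by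
  refine mem_triangleClasses_iff.2 ⟨classShape i e x, classShape_ne_zero i e x,
    (argModPi (classDirs i e x 0), argModPi (classDirs i e x 1), argModPi (classDirs i e x 2)),
    classShape_sum i e x, rfl, fun l hl => ?_, fun l => ?_⟩
  · rw [coord3_mk fun l => argModPi (classDirs i e x l), argModPi_classDirs i hl]
  · rw [coord3_mk fun l => argModPi (classDirs i e x l),
      coord3_mk fun l => argModPi (classDirs i e x l)]
    exact coord3_mk (classAngle i e x) l

theorem coord3_classChart (x : Fin 2 → ℝ) (l : Fin 3) :
    coord3 (classChart i e x).2.1 l = classAngle i e x l := coord3_mk (classAngle i e x) l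

/-- The angle of index `i + 2` is the difference of the directions at `i` and `i + 1`, and the
latter is normalized to `1`. Hence this angle carries the slope coordinate. -/
theorem classAngle_add_two (x : Fin 2 → ℝ) :
    classAngle i e x (i + 2) = argModPi (slopeVec e (x 1)) := by
  rw [classAngle, fin3_add_two_add_one, fin3_add_two_add_two, classDirs, cyc_zero, cyc_one,
    argModPi_one, sub_zero]

theorem classChart_mem_domain (he : e ≠ 0) {x : Fin 2 → ℝ}
    (hx : MvPolynomial.eval x (classChartPoly e) ≠ 0) :
    classChart i e x ∈ classChartDomain i e := by
  refine ⟨(mk_mem_componentDomain _).2 (by simp [classShape]),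
    (mk_mem_componentDomain _).2 ?_, ?_⟩
  · rw [classShape, cyc_two]
    rw [eval_classChartPoly] at hx
    exact (map_ne_zero _).1 hx
  · rw [coord3_classChart, classAngle_add_two]
    exact argModPi_slopeVec_mem he _

theorem classAmbient_reg_coords {ω : ClassPoint} (hω : ω ∈ classChartDomain i e) (j : Fin 2) :
    classAmbient.Reg (fun ω : ClassPoint => classCoords i e ω j) ω := by
  fin_cases j
  · exact (regAt_classShape ω).reg (reg_componentRatio e hω.1)
  · exact (regAt_angle ω (i + 2)).reg (circle_reg_slope hω.2.2)

theorem classCoords_chart (he : e ≠ 0) (x : Fin 2 → ℝ) :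
    classCoords i e (classChart i e x) = x := by
  funext j
  fin_cases j
  · change (componentRatio i (i + 1) (Projectivization.mk ℂ _ _) / e).re = _
    rw [componentRatio_mk, classShape, cyc_zero, cyc_one, div_one, ofReal_mul_div_re,
      slopeVec_div he]
    simp
  · change slope e (coord3 (classChart i e x).2.1 (i + 2)) = _
    rw [coord3_classChart, classAngle_add_two, slope_argModPi_slopeVec he]
    rfl

/-- Division by `w (i + 1)` normalizes the sides and subtracts `coord3 η (i + 1)` from every
argument; the common shift cancels in the angles. -/
theorem exists_of_mem_classChartDomain (he : e ≠ 0) {ω : ClassPoint} (hω : ω ∈ triangleClasses)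
    (hU : ω ∈ classChartDomain i e) :
    ∃ x, MvPolynomial.eval x (classChartPoly e) ≠ 0 ∧ classChart i e x = ω := by
  obtain ⟨w, hw, η, hsum, hc, harg, hθ⟩ := mem_triangleClasses_iff.1 hω
  obtain ⟨⟨c, hcS⟩, ⟨θ, hθT⟩⟩ := ω
  obtain ⟨h1, h2, h3⟩ := hU
  change c = _ at hc
  subst hc
  have hw1 : w (i + 1) ≠ 0 := (mk_mem_componentDomain hw).1 h1
  have hw2 : w (i + 2) ≠ 0 := (mk_mem_componentDomain hw).1 h2
  have hs2 : w (i + 2) = -w i - w (i + 1) := by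
    have := fin3_sum w i
    rw [hsum] at this
    linear_combination this
  have hθi : coord3 θ (i + 2) = coord3 η i - coord3 η (i + 1) := by
    have := hθ (i + 2)
    rwa [fin3_add_two_add_one, fin3_add_two_add_two] at this
  -- When `w i ≠ 0`, the argument of this quotient is the angle of index `i + 2`; when `w i = 0`,
  -- that angle is unconstrained by the quotient.
  have hz : w i / w (i + 1) = (w i / w (i + 1) / e).re * slopeVec e (slope e (coord3 θ (i + 2))) := by
    refine eq_re_mul_slopeVec_slope he h3 fun h0 => ?_
    have hwi : w i ≠ 0 := (div_ne_zero_iff.1 h0).1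
    rw [hθi, harg _ hwi, harg _ hw1, argModPi_div hwi hw1]
  let x : Fin 2 → ℝ := ![(w i / w (i + 1) / e).re, slope e (coord3 θ (i + 2))]
  have hsh0 : (x 0 : ℂ) * slopeVec e (x 1) = (w (i + 1))⁻¹ * w i := by
    rw [mul_comm _ (w i), ← div_eq_mul_inv]
    exact hz.symm
  have hsh2 : -((x 0 : ℂ) * slopeVec e (x 1)) - 1 = (w (i + 1))⁻¹ * w (i + 2) := by
    rw [hsh0, hs2]
    field_simp
  have hsh : classShape i e x = (w (i + 1))⁻¹ • w :=
    (eq_cyc (f := (w (i + 1))⁻¹ • w) i _ _ _ hsh0.symm (inv_mul_cancel₀ hw1) hsh2.symm).symm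
  have hdir : ∀ l, argModPi (classDirs i e x l) = coord3 η l - coord3 η (i + 1) := by
    intro l
    rcases fin3_cases i l with rfl | rfl | rfl
    · rw [classDirs, cyc_zero, ← hθi]
      exact argModPi_slopeVec_slope he h3
    · rw [classDirs, cyc_one, argModPi_one, sub_self]
    · rw [classDirs, cyc_two, hsh2, mul_comm, ← div_eq_mul_inv, argModPi_div hw2 hw1, harg _ hw2,
        harg _ hw1]
  refine ⟨x, ?_, Prod.ext (Subtype.ext ?_) (Subtype.ext (coord3_ext fun l => ?_))⟩
  · rw [eval_classChartPoly, hsh2]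
    exact (map_ne_zero _).2 (mul_ne_zero (inv_ne_zero hw1) hw2)
  · refine (Projectivization.mk_eq_mk_iff' ℂ _ _ _ _).2 ⟨(w (i + 1))⁻¹, ?_⟩
    rw [hsh]
  · rw [coord3_classChart, classAngle, hdir, hdir, sub_sub_sub_cancel_right]
    exact (hθ l).symm

end chart

theorem exists_mem_classChartDomain {ω : ClassPoint} (hω : ω ∈ triangleClasses) :
    ∃ k : Fin 3 × Bool, ω ∈ classChartDomain k.1 (axis k.2) := by
  obtain ⟨w, hw, η, hsum, hc, -⟩ := mem_triangleClasses_iff.1 hω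
  obtain ⟨i, h1, h2⟩ := exists_two_ne_zero hw hsum
  obtain ⟨b, hb⟩ := exists_mem_slopeDomain_axis (coord3 ω.2.1 (i + 2))
  refine ⟨(i, b), ?_, ?_, hb⟩
  · rw [hc]
    exact (mk_mem_componentDomain hw).2 h1
  · rw [hc]
    exact (mk_mem_componentDomain hw).2 h2

theorem classSpace_isSmoothVariety : classSpace.IsSmoothVariety := by
  refine isSmoothVariety_of_charts classAmbient_separatesPoints
    (fun k : Fin 3 × Bool => classChartDomain k.1 (axis k.2))
    (fun k => isOpen_classChartDomain _ _) (fun ω hω => exists_mem_classChartDomain hω)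
    fun ⟨i, b⟩ => ?_
  have he := axis_ne_zero b
  refine isSmoothAffine_of_chart (classChartPoly (axis b)) (classChart i (axis b))
    (classCoords i (axis b)) (fun x hx => regAt_classChart i he hx)
    (fun x _ => classChart_mem i x) (fun x hx => classChart_mem_domain i he hx)
    (fun ω hω j => classAmbient_reg_coords i hω j) ?_ (fun x _ => classCoords_chart i he x) ?_
  · intro ω hω hU
    obtain ⟨x, hx, rfl⟩ := exists_of_mem_classChartDomain i he hω hU
    rwa [classCoords_chart i he]
  · intro ω hω hU
    obtain ⟨x, hx, rfl⟩ := exists_of_mem_classChartDomain i he hω hU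
    rw [classCoords_chart i he]

end TriangleModuli

open TriangleModuli in
/-- The spaces of triangles and of triangle classes are smooth real varieties; they represent the
moduli functors of triangles and of triangle classes, with the tautological families as universal
families. -/
theorem theorem6p1 :
    (∃ hT : triangleSpace.IsSmoothVariety,
      IsFineModuliSpace triangleFunctor ⟨triangleSpace, hT⟩
        (tautologicalFamily triangleAmbient triangles hT)) ∧
    (∃ hD : classSpace.IsSmoothVariety,
      IsFineModuliSpace classFunctor ⟨classSpace, hD⟩
        (tautologicalFamily classAmbient triangleClasses hD)) :=
  ⟨⟨triangleSpace_isSmoothVariety, isFineModuliSpace_tautologicalFamily _⟩,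
    ⟨classSpace_isSmoothVariety, isFineModuliSpace_tautologicalFamily _⟩⟩
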